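/- For $v\ge 1$, label the vertices of the complete graph $K_v$ by $0,1,\ldots,v-1$ and define the (cyclic) length of the edge joining distinct vertices $x,y$ to be $\min(|y-x|,\,v-|y-x|)$. A multiset $L$ of size $v-1$ whose elements lie in $\{1,\ldots,\lfloor v/2\rfloor\}$ is *realizable* if there is a Hamiltonian path of $K_v$ whose multiset of edge lengths is $L$. The *support* of $L$ is the set of its distinct elements. The Buratti--Horak--Rosa (BHR) Conjecture for $L$ asserts that $L$ is realizable if and only if, for every divisor $d$ of $v$, the number of multiples of $d$ in $L$ (counted with multiplicity) is at most $v-d$; Buratti's Conjecture for a support $U$ asserts that this holds for every prime $v$ and every multiset $L$ of size $v-1$ with support $U\subseteq\{1,\ldots,\lfloor v/2\rfloor\}$. **Corollary (Computer findings).** Let $U$ be one of $\{1,7,8\}$, $\{1,9,10\}$, $\{1,10,11\}$. Let $L$ be a multiset of size $v-1$ with support $U$, where $U\subseteq\{1,\ldots,\lfloor v/2\rfloor\}$ and $v$ is coprime to every element of $U$. Then $L$ is realizable. In particular, Buratti's Conjecture holds for multisets with support $U$. -/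

import Mathlib

/-- The (cyclic) length `min (|y - x|, v - |y - x|)` of the edge joining the vertices labeled `x`
and `y` of the complete graph `K_v` on the labels `0, 1, …, v - 1`. -/
def cyclicLength (v : ℕ) (x y : Fin v) : ℕ :=
  min (Nat.dist x.val y.val) (v - Nat.dist x.val y.val)

theorem cyclicLength_comm (v : ℕ) (x y : Fin v) : cyclicLength v x y = cyclicLength v y x := by
  simp only [cyclicLength, Nat.dist_comm]

/-- The (cyclic) length of an edge of `K_v`, as a function of the unordered pair. -/
def edgeLength (v : ℕ) : Sym2 (Fin v) → ℕ :=
  Sym2.lift ⟨cyclicLength v, cyclicLength_comm v⟩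

/-- The walk `Γ` of `K_v` (cyclically) realizes the multiset `L`: it is a Hamiltonian path and `L`
is the multiset of the lengths of its edges. -/
def Realizes (v : ℕ) {s t : Fin v} (Γ : (SimpleGraph.completeGraph (Fin v)).Walk s t) (L : Multiset ℕ) : Prop :=
  Γ.IsHamiltonian ∧ ((Γ.edges.map (edgeLength v) : List ℕ) : Multiset ℕ) = L

/-- There is a (cyclic) realization of `L` in `K_v`. -/
def IsRealizable (v : ℕ) (L : Multiset ℕ) : Prop :=
  ∃ (s t : Fin v) (Γ : (SimpleGraph.completeGraph (Fin v)).Walk s t), Realizes v Γ L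

/-- `L` is a multiset of size `v - 1` with support contained in `{1, …, ⌊v/2⌋}`. -/
def IsBHRInstance (v : ℕ) (L : Multiset ℕ) : Prop :=
  L.card + 1 = v ∧ L.toFinset ⊆ Finset.Icc 1 (v / 2)

/-- The Buratti-Horak-Rosa condition: for any divisor `d` of `v` the number of multiples of `d`
in `L` is at most `v - d`. -/
def BHRCondition (v : ℕ) (L : Multiset ℕ) : Prop :=
  ∀ d : ℕ, d ∣ v → L.countP (fun l => d ∣ l) + d ≤ v

/-- The Buratti-Horak-Rosa Conjecture holds at order `v` for multisets with support `U`. -/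
def BHRHoldsFor (v : ℕ) (U : Finset ℕ) : Prop :=
  ∀ L : Multiset ℕ, IsBHRInstance v L → L.toFinset = U → (IsRealizable v L ↔ BHRCondition v L)

/-- Buratti's Conjecture (the Buratti-Horak-Rosa Conjecture at prime orders) holds for multisets
with support `U`. -/
def BurattiHoldsFor (U : Finset ℕ) : Prop :=
  ∀ v : ℕ, v.Prime → BHRHoldsFor v U

/-!
Traverse a Hamiltonian path of `K_v` as a sequence of steps on the circle `ℤ/v`, each step of length
`n` going `n` places clockwise or counterclockwise; the arc of a step starts at its counterclockwise
end. A *cut* `m` is the gap between the vertices `m` and `m + 1`, and the *depth* of an arc crossing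
it is the distance from the start of the arc to `m`.

Suppose that the arcs crossing the cut `m` have depths `0, 1, …, x - 1`, each exactly once. Insert
`x` new vertices into the gap. An arc of length `n` from `t` to `t + n` that crosses the cut is
replaced by an arc of length `x` from `t` to a new vertex followed by an arc of length `n`; arcs
that do not cross keep their lengths. The result is again a Hamiltonian path, with `x` more edges
of length `x`, and at every cut of the old circle, `m` included, the list of depths stays the same
(`depths_grow`). So the step can be repeated, and repeated for several lengths independently, each
with its own cut: one realization of `L` that is *growable* by all `g ∈ G` yields realizations of
all multisets obtained from `L` by adding, for each `g ∈ G`, a multiple of `g` copies of `g`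
(`Growable.grow_iter`).

A multiset with support `{1, x, x + 1}` is given by its multiplicities `(a, b, c)`. A growable
realization covers all triples obtained by increasing `a` by any amount, `b` by multiples of `x` or
`c` by multiples of `x + 1`, as far as it is growable by the length in question. For each of
`x = 7, 9, 10` an explicit finite list of growable realizations covers all positive triples whose
`v = a + b + c + 1` is at least `2 (x + 1)` and coprime to `x` and `x + 1`. That each entry of a list
is a growable realization as claimed (`valid`), and that every triple is covered (`complete`, a
finite check since large multiplicities may be reduced within their residue class), is verified by
evaluation. For a prime `v` the divisor condition is automatic, as is coprimality, which gives
Buratti's Conjecture.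
-/

namespace BHR

/-! ### Walks on the circle -/

/-- A step on the circle: a direction (`true` is clockwise, that is, increasing) and a length. -/
abbrev Step := Bool × ℕ

/-- The end of the step `s` taken from `p` on the circle with vertices `0, …, v - 1`. Meaningful for
`p < v` and `s.2 < v`, when a single correction by `v` reduces modulo `v`. -/
def next (v p : ℕ) (s : Step) : ℕ :=
  if s.1 then (if p + s.2 < v then p + s.2 else p + s.2 - v)
  else (if s.2 ≤ p then p - s.2 else p + v - s.2)

/-- The start of the clockwise arc that the step `s` from `p` traverses in one of the two directions. -/
def tail (v p : ℕ) (s : Step) : ℕ := if s.1 then p else next v p s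

/-- The clockwise distance from `t` to `m`. An arc of length `n` starting at `t` crosses the cut between
`m` and `m + 1` if and only if `depth v m t < n`. -/
def depth (v m t : ℕ) : ℕ := if t ≤ m then m - t else m + v - t

/-- The vertices visited by a sequence of steps from `p`. -/
def verts (v : ℕ) : ℕ → List Step → List ℕ
  | p, [] => [p]
  | p, s :: l => p :: verts v (next v p s) l

/-- The depths of the arcs crossing the cut `m`, in the order of traversal. -/
def depths (v m : ℕ) : ℕ → List Step → List ℕ
  | _, [] => []
  | p, s :: l =>
    if depth v m (tail v p s) < s.2 then depth v m (tail v p s) :: depths v m (next v p s) l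
    else depths v m (next v p s) l

/-- The two steps replacing a step whose arc crosses the cut: the arc of length `x` comes first when the
arc is traversed clockwise, last otherwise. -/
def detour (x : ℕ) (s : Step) : List Step := if s.1 then [(true, x), s] else [s, (false, x)]

/-- The step sequence after inserting `x` new vertices into the cut `m`. -/
def grow (v m x : ℕ) : ℕ → List Step → List Step
  | _, [] => []
  | p, s :: l =>
    if depth v m (tail v p s) < s.2 then detour x s ++ grow v m x (next v p s) l
    else s :: grow v m x (next v p s) l

/-- The new label of the old vertex `p` when `x` vertices are inserted after `m`. -/
def lift (m x p : ℕ) : ℕ := if p ≤ m then p else p + x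

theorem lift_injective (m x : ℕ) : Function.Injective (lift m x) := by
  intro p q h
  unfold lift at h
  split_ifs at h <;> omega

theorem next_lt {v p : ℕ} {s : Step} (hp : p < v) (hs : s.2 < v) : next v p s < v := by
  unfold next
  split_ifs <;> omega

theorem next_lift {v m x p : ℕ} {s : Step} (hp : p < v) (hm : m < v) (hs : s.2 < v)
    (h : ¬ depth v m (tail v p s) < s.2) :
    next (v + x) (lift m x p) s = lift m x (next v p s) := by
  obtain ⟨b, n⟩ := s
  cases b <;> simp only [depth, tail, next, lift, if_true, Bool.false_eq_true, if_false] at * <;>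
    split_ifs at * <;> omega

/-- The new vertex on an arc of depth `d` is `m + x - d`; for `d < x` these are the inserted vertices. -/
theorem next_lift_true {v m x p : ℕ} (hp : p < v) (hm : m < v)
    (hx : depth v m p < x) :
    next (v + x) (lift m x p) (true, x) = m + x - depth v m p := by
  simp only [depth, next, lift, if_true] at *
  split_ifs at * <;> omega

theorem next_new_true {v m x p n : ℕ} (hp : p < v) (hm : m < v) (hs : n < v)
    (h : depth v m p < n) (hx : depth v m p < x) :
    next (v + x) (m + x - depth v m p) (true, n) = lift m x (next v p (true, n)) := by
  simp only [depth, next, lift, if_true] at *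
  split_ifs at * <;> omega

theorem next_lift_false {v m x p n : ℕ} (hp : p < v) (hs : n < v)
    (h : depth v m (next v p (false, n)) < n) (hx : depth v m (next v p (false, n)) < x) :
    next (v + x) (lift m x p) (false, n) = m + x - depth v m (next v p (false, n)) := by
  simp only [depth, next, lift, Bool.false_eq_true, if_false] at *
  split_ifs at * <;> omega

theorem next_new_false {v m x q : ℕ} (hq : q < v) (hx : depth v m q < x) :
    next (v + x) (m + x - depth v m q) (false, x) = lift m x q := by
  simp only [depth, next, lift, Bool.false_eq_true, if_false] at *
  split_ifs at * <;> omega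

/-- The grown walk visits the old vertices and one new vertex for each arc crossing the cut. -/
theorem verts_grow {v m x : ℕ} (hm : m < v) (l : List Step) :
    ∀ p < v, (∀ s ∈ l, s.2 < v) → (∀ d ∈ depths v m p l, d < x) →
      (verts (v + x) (lift m x p) (grow v m x p l)).Perm
        ((verts v p l).map (lift m x) ++ (depths v m p l).map (fun d => m + x - d)) := by
  induction l with
  | nil => intro p _ _ _; simp [verts, grow, depths]
  | cons s l ih =>
    intro p hp hs hd
    have hs0 : s.2 < v := hs s (by simp)
    have hn := next_lt hp hs0
    have ih := ih _ hn (fun t ht => hs t (by simp [ht]))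
    by_cases h : depth v m (tail v p s) < s.2
    · simp only [depths, h, if_true, List.forall_mem_cons] at hd
      have ih := ih hd.2
      obtain ⟨b, n⟩ := s
      cases b
      · simp only [tail, Bool.false_eq_true, if_false] at h hd
        simp only [verts, grow, depths, tail, Bool.false_eq_true, if_false, h, if_true, detour,
          List.cons_append, List.nil_append, List.map_cons, next_lift_false hp hs0 h hd.1,
          next_new_false hn hd.1]
        exact (((ih.cons _).trans List.perm_middle.symm)).cons _
      · simp only [tail, if_true] at h hd
        simp only [verts, grow, depths, tail, h, if_true, detour,
          List.cons_append, List.nil_append, List.map_cons, next_lift_true hp hm hd.1,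
          next_new_true hp hm hs0 h hd.1]
        exact (((ih.cons _).trans List.perm_middle.symm)).cons _
    · simp only [depths, h, if_false] at hd
      simp only [verts, grow, depths, h, if_false, List.map_cons, List.cons_append,
        next_lift (x := x) hp hm hs0 h]
      exact (ih hd).cons _

/-- If an arc of depth less than `x` at the cut `m` is replaced by its detour, then at any cut `m'` it is
either the arc of length `x` or the arc of length `n` that inherits the crossing and its depth, and
neither of them crosses if the original arc did not. -/
theorem depth_detour {v m m' x t n : ℕ} (hm : m < v) (hm' : m' < v) (ht : t < v) (hn : n < v)
    (h : depth v m t < n) (hx : depth v m t < x) :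
    (depth v m' t < n ∧ depth (v + x) (lift m x m') (lift m x t) = depth v m' t ∧
      depth v m' t < x ∧ ¬ depth (v + x) (lift m x m') (m + x - depth v m t) < n) ∨
    (depth v m' t < n ∧ depth (v + x) (lift m x m') (m + x - depth v m t) = depth v m' t ∧
      ¬ depth (v + x) (lift m x m') (lift m x t) < x) ∨
    (¬ depth v m' t < n ∧ ¬ depth (v + x) (lift m x m') (m + x - depth v m t) < n ∧
      ¬ depth (v + x) (lift m x m') (lift m x t) < x) := by
  simp only [depth, lift] at *
  split_ifs at * <;> omega

/-- An arc that does not cross the cut `m` crosses the other cuts as before the insertion. -/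
theorem depth_lift {v m m' x t n : ℕ} (hm : m < v) (ht : t < v)
    (h : ¬ depth v m t < n) :
    (depth v m' t < n ∧ depth (v + x) (lift m x m') (lift m x t) = depth v m' t) ∨
    (¬ depth v m' t < n ∧ ¬ depth (v + x) (lift m x m') (lift m x t) < n) := by
  simp only [depth, lift] at *
  split_ifs at * <;> omega

theorem tail_lt {v p : ℕ} {s : Step} (hp : p < v) (hs : s.2 < v) : tail v p s < v := by
  unfold tail
  split_ifs
  exacts [hp, next_lt hp hs]

theorem tail_lift {v m x p : ℕ} {s : Step} (hp : p < v) (hm : m < v) (hs : s.2 < v)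
    (h : ¬ depth v m (tail v p s) < s.2) :
    tail (v + x) (lift m x p) s = lift m x (tail v p s) := by
  unfold tail
  rw [next_lift hp hm hs h]
  split_ifs <;> rfl

/-- Growing at the cut `m` leaves the depths at every cut unchanged, so that the walk can be grown again at
any of them. -/
theorem depths_grow {v m m' x : ℕ} (hm : m < v) (hm' : m' < v) (l : List Step) :
    ∀ p < v, (∀ s ∈ l, s.2 < v) → (∀ d ∈ depths v m p l, d < x) →
      depths (v + x) (lift m x m') (lift m x p) (grow v m x p l) = depths v m' p l := by
  induction l with
  | nil => intro p _ _ _; simp [grow, depths]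
  | cons s l ih =>
    intro p hp hs hd
    have hs0 : s.2 < v := hs s (by simp)
    have hn := next_lt hp hs0
    have ih := ih _ hn (fun t ht => hs t (by simp [ht]))
    by_cases h : depth v m (tail v p s) < s.2
    · simp only [depths, h, if_true, List.forall_mem_cons] at hd
      have ih := ih hd.2
      have key := depth_detour hm hm' (tail_lt hp hs0) hs0 h hd.1
      obtain ⟨b, n⟩ := s
      cases b
      · simp only [tail, Bool.false_eq_true, if_false] at h hd key
        simp only [grow, depths, tail, Bool.false_eq_true, if_false, h, if_true, detour,
          List.cons_append, List.nil_append, next_lift_false hp hs0 h hd.1,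
          next_new_false hn hd.1, ih]
        rcases key with ⟨h1, h2, h3, h4⟩ | ⟨h1, h2, h3⟩ | ⟨h1, h2, h3⟩
        · simp only [h1, h2, h3, h4, if_true, if_false]
        · simp only [h1, h2, h3, if_true, if_false]
        · simp only [h1, h2, h3, if_false]
      · simp only [tail, if_true] at h hd key
        simp only [grow, depths, tail, h, if_true, detour,
          List.cons_append, List.nil_append, next_lift_true hp hm hd.1,
          next_new_true hp hm hs0 h hd.1, ih]
        rcases key with ⟨h1, h2, h3, h4⟩ | ⟨h1, h2, h3⟩ | ⟨h1, h2, h3⟩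
        · simp only [h1, h2, h3, h4, if_true, if_false]
        · simp only [h1, h2, h3, if_true, if_false]
        · simp only [h1, h2, h3, if_false]
    · simp only [depths, h, if_false] at hd
      have ih := ih hd
      simp only [grow, depths, h, if_false, next_lift (x := x) hp hm hs0 h, ih,
        tail_lift (x := x) hp hm hs0 h]
      rcases depth_lift (x := x) (m' := m') hm (tail_lt hp hs0) h with ⟨h1, h2⟩ | ⟨h1, h2⟩
      · simp only [h1, h2, if_true]
      · simp only [h1, h2, if_false]

theorem lengths_grow {v m x : ℕ} (l : List Step) : ∀ p,
    (((grow v m x p l).map Prod.snd : List ℕ) : Multiset ℕ) =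
      ((l.map Prod.snd : List ℕ) : Multiset ℕ) + Multiset.replicate (depths v m p l).length x := by
  induction l with
  | nil => intro p; simp [grow, depths]
  | cons s l ih =>
    intro p
    by_cases h : depth v m (tail v p s) < s.2
    · have ih := ih (next v p s)
      obtain ⟨b, n⟩ := s
      cases b <;>
      · simp only [grow, depths, h, if_true, detour, List.map_cons,
          List.cons_append, List.nil_append, Bool.false_eq_true, if_false, ← Multiset.cons_coe, ih, List.length_cons,
          Multiset.replicate_succ, Multiset.add_cons, Multiset.cons_add]
        try rw [Multiset.cons_swap]
    · simp [grow, depths, h, ← Multiset.cons_coe, ih]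

/-- There is a Hamiltonian walk on the circle with step lengths `L` such that for every `g ∈ G` the arcs
crossing some cut have the depths `0, …, g - 1`, each once. Lengths are below the number of vertices but
need not be at most half of it, so the arcs need not be the shorter ones. -/
def Growable (G : Finset ℕ) (L : Multiset ℕ) : Prop :=
  ∃ (p : ℕ) (l : List Step), ((l.map Prod.snd : List ℕ) : Multiset ℕ) = L ∧
    p < L.card + 1 ∧ (∀ n ∈ L, n < L.card + 1) ∧ (verts (L.card + 1) p l).Nodup ∧
    ∀ g ∈ G, ∃ m < L.card + 1, (depths (L.card + 1) m p l).Perm (List.range g)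

theorem depths_lt {v m : ℕ} (l : List Step) : ∀ p, ∀ d ∈ depths v m p l, ∃ s ∈ l, d < s.2 := by
  induction l with
  | nil => intro p d hd; simp [depths] at hd
  | cons s l ih =>
    intro p d hd
    simp only [depths] at hd
    split_ifs at hd with h
    · rcases List.mem_cons.1 hd with rfl | hd
      · exact ⟨s, by simp, h⟩
      · obtain ⟨t, ht, h⟩ := ih _ d hd
        exact ⟨t, by simp [ht], h⟩
    · obtain ⟨t, ht, h⟩ := ih _ d hd
      exact ⟨t, by simp [ht], h⟩

/-- A realization growable by `x` yields one with `x` more steps of length `x`, growable by the same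
lengths. -/
theorem Growable.grow {G : Finset ℕ} {L : Multiset ℕ} (h : Growable G L) {x : ℕ} (hx : x ∈ G) :
    Growable G (L + Multiset.replicate x x) := by
  obtain ⟨p, l, hL, hp, hlt, hnd, hG⟩ := h
  obtain ⟨m, hm, hd⟩ := hG x hx
  have hl : ∀ s ∈ l, s.2 < L.card + 1 := fun s hs =>
    hlt _ (by rw [← hL]; exact Multiset.mem_coe.2 (List.mem_map_of_mem hs))
  have hdx : ∀ d ∈ depths (L.card + 1) m p l, d < x := fun d hd' =>
    List.mem_range.1 (hd.mem_iff.1 hd')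
  have hxv : x < L.card + 1 := by
    rcases Nat.eq_zero_or_pos x with rfl | hx0
    · omega
    · obtain ⟨s, hs, h⟩ := depths_lt l p (x - 1) (hd.mem_iff.2 (List.mem_range.2 (by omega)))
      have := hl s hs
      omega
  have hc : (L + Multiset.replicate x x).card + 1 = L.card + 1 + x := by
    simp only [Multiset.card_add, Multiset.card_replicate]; omega
  refine ⟨lift m x p, BHR.grow (L.card + 1) m x p l, ?_, ?_, ?_, ?_, ?_⟩
  · rw [lengths_grow, hL, hd.length_eq, List.length_range]
  · rw [hc]; unfold lift; split_ifs <;> omega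
  · intro n hn
    rw [hc]
    rcases Multiset.mem_add.1 hn with hn | hn
    · have := hlt n hn; omega
    · rw [Multiset.eq_of_mem_replicate hn]; omega
  · rw [hc, (verts_grow hm l p hp hl hdx).nodup_iff]
    refine List.Nodup.append (hnd.map (lift_injective m x)) (List.Nodup.map_on ?_ ?_) ?_
    · intro d hd' e he h
      have := hdx d hd'
      have := hdx e he
      omega
    · exact hd.nodup_iff.2 List.nodup_range
    · intro q hq hq'
      obtain ⟨r, -, rfl⟩ := List.mem_map.1 hq
      obtain ⟨d, hd', h⟩ := List.mem_map.1 hq'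
      have := hdx d hd'
      unfold lift at h
      split_ifs at h <;> omega
  · intro g hg
    obtain ⟨m', hm', h⟩ := hG g hg
    refine ⟨lift m x m', ?_, ?_⟩
    · rw [hc]; unfold lift; split_ifs <;> omega
    · rwa [hc, depths_grow hm hm' l p hp hl hdx]

theorem Growable.grow_iter {G : Finset ℕ} {L : Multiset ℕ} (h : Growable G L) {x : ℕ} (hx : x ∈ G)
    (k : ℕ) : Growable G (L + Multiset.replicate (k * x) x) := by
  induction k with
  | zero => simpa using h
  | succ k ih => rw [Nat.succ_mul, Multiset.replicate_add, ← add_assoc]; exact ih.grow hx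

/-! ### From step sequences to walks of the complete graph -/

theorem edgeLength_next {v p : ℕ} {s : Step} (hp : p < v) (hs : s.2 < v) (h : 2 * s.2 ≤ v) :
    edgeLength v s(⟨p, hp⟩, ⟨next v p s, next_lt hp hs⟩) = s.2 := by
  simp only [edgeLength, Sym2.lift_mk, cyclicLength, next, Nat.dist]
  split_ifs <;> omega

theorem exists_walk {v : ℕ} (l : List Step) (hl : ∀ s ∈ l, 0 < s.2 ∧ s.2 < v ∧ 2 * s.2 ≤ v) :
    ∀ (p : ℕ) (hp : p < v),
      ∃ (t : Fin v) (Γ : (SimpleGraph.completeGraph (Fin v)).Walk ⟨p, hp⟩ t),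
        Γ.support.map Fin.val = verts v p l ∧ Γ.edges.map (edgeLength v) = l.map Prod.snd := by
  induction l with
  | nil => intro p hp; exact ⟨_, .nil, by simp [verts], by simp⟩
  | cons s l ih =>
    intro p hp
    obtain ⟨hs0, hs, hs2⟩ := hl s (by simp)
    obtain ⟨t, Γ, hv, he⟩ := ih (fun r hr => hl r (by simp [hr])) _ (next_lt hp hs)
    have hadj : (SimpleGraph.completeGraph (Fin v)).Adj ⟨p, hp⟩ ⟨next v p s, next_lt hp hs⟩ := by
      simp only [SimpleGraph.completeGraph_eq_top, SimpleGraph.top_adj, ne_eq, Fin.mk.injEq, next]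
      split_ifs <;> omega
    refine ⟨t, .cons hadj Γ, ?_, ?_⟩
    · simp [verts, hv]
    · simp [he, edgeLength_next hp hs hs2]

theorem length_verts (v : ℕ) (l : List Step) : ∀ p, (verts v p l).length = l.length + 1 := by
  induction l with
  | nil => intro p; rfl
  | cons s l ih => intro p; simp [verts, ih]

/-- The labels visited by a Hamiltonian walk on the circle form a Hamiltonian path of `K_v`, and since no
length exceeds `v / 2`, the length of an edge is that of the step. -/
theorem Growable.isRealizable {G : Finset ℕ} {v : ℕ} {L : Multiset ℕ} (h : Growable G L)
    (hL : IsBHRInstance v L) : IsRealizable v L := by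
  obtain ⟨p, l, rfl, hp, hlt, hnd, -⟩ := h
  obtain ⟨rfl, hsub⟩ := hL
  obtain ⟨t, Γ, hv, he⟩ := exists_walk l (fun s hs => by
    have hs' : s.2 ∈ ((l.map Prod.snd : List ℕ) : Multiset ℕ) :=
      Multiset.mem_coe.2 (List.mem_map_of_mem hs)
    have h1 := hlt _ hs'
    have h2 := Finset.mem_Icc.1 (hsub (Multiset.mem_toFinset.2 hs'))
    omega) p hp
  have hnd' : Γ.support.Nodup := List.Nodup.of_map Fin.val (hv ▸ hnd)
  refine ⟨_, t, Γ, fun a => List.count_eq_one_of_mem hnd' ?_, by rw [he]⟩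
  have hcard : Γ.support.toFinset.card = Fintype.card (Fin (Multiset.card ((l.map Prod.snd : List ℕ) : Multiset ℕ) + 1)) := by
    rw [List.toFinset_card_of_nodup hnd', ← List.length_map (f := Fin.val), hv, length_verts]
    simp
  have := (Finset.card_eq_iff_eq_univ _).1 hcard
  exact List.mem_toFinset.1 (this ▸ Finset.mem_univ a)

/-- At prime order only the divisors `1` and `v` matter, and no length is a multiple of `v`. -/
theorem bhrCondition_of_prime {v : ℕ} (hv : v.Prime) {L : Multiset ℕ} (hL : IsBHRInstance v L) :
    BHRCondition v L := by
  intro d hd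
  obtain ⟨hc, hsub⟩ := hL
  rcases (Nat.dvd_prime hv).1 hd with rfl | rfl
  · have := Multiset.countP_le_card (fun l => 1 ∣ l) L
    omega
  · have : L.countP (fun l => d ∣ l) = 0 := by
      refine Multiset.countP_eq_zero.2 fun l hl hdl => ?_
      have h1 := Finset.mem_Icc.1 (hsub (Multiset.mem_toFinset.2 hl))
      have := Nat.le_of_dvd h1.1 hdl
      omega
    omega

/-! ### Checking encoded growable realizations and their coverage -/

/-- The multiset in which `1`, `x` and `x + 1` have the multiplicities `a`, `b` and `c`. -/
def triple (x a b c : ℕ) : Multiset ℕ :=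
  Multiset.replicate a 1 + Multiset.replicate b x + Multiset.replicate c (x + 1)

/-- The `i`-th base-64 digit of `e`. -/
def digit (e i : ℕ) : ℕ := (e >>> (6 * i)) % 64

/-- The step with code `d < 6`: even codes are clockwise, and `d / 2` selects the length. -/
def stepOfCode (x d : ℕ) : Step :=
  (d % 2 == 0, if d < 2 then 1 else if d < 4 then x else x + 1)

/-- The steps given by the `n` lowest base-6 digits, the first step being the lowest digit. -/
def decode (x : ℕ) : ℕ → ℕ → List Step
  | 0, _ => []
  | n + 1, e => stepOfCode x (e % 6) :: decode x n (e / 6)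

/-- The entries of the list are distinct, and none of them is the position of a one in `k`. The visited
numbers are collected in `k` as a bit mask, for speed of evaluation. -/
def distinct : ℕ → List ℕ → Bool
  | _, [] => true
  | k, p :: l => !k.testBit p && distinct (k ||| 1 <<< p) l

/-- The list is a permutation of `0, …, n - 1`. -/
def isRange (n : ℕ) (l : List ℕ) : Bool :=
  l.length == n && l.all (· < n) && distinct 0 l

/-- Either `m = 0`, which stands for no cut, or the walk from `0` is growable by `g` at the cut `m - 1`. -/
def cutOk (v m g : ℕ) (l : List Step) : Bool :=
  m == 0 || (m ≤ v && isRange g (depths v (m - 1) 0 l))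

/-- The number `e` encodes a growable realization starting at the vertex `0`. Its base-64 digits `0` to `2`
are the multiplicities of `1`, `x` and `x + 1`, its digits `3` to `5` are one plus the cut for growing by
`1`, `x` and `x + 1`, or `0` if there is none, and the rest encodes the steps. -/
def valid (x e : ℕ) : Bool :=
  let a := digit e 0
  let b := digit e 1
  let c := digit e 2
  let v := a + b + c + 1
  let l := decode x (a + b + c) (e >>> 36)
  let lens := l.map Prod.snd
  x + 1 < v && lens.count 1 == a && lens.count x == b && lens.count (x + 1) == c &&
    distinct 0 (verts v 0 l) &&
    cutOk v (digit e 3) 1 l && cutOk v (digit e 4) x l && cutOk v (digit e 5) (x + 1) l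

/-- A multiplicity `n₀`, increased by multiples of `g` if `m ≠ 0`, can be brought to `n`. Beyond the bound
`N`, where `n` stands for a whole residue class modulo `g`, the ability to grow is demanded even if
`n₀ = n`. -/
def reaches (g N m n₀ n : ℕ) : Bool :=
  (n₀ == n && n ≤ N) || (m != 0 && n₀ ≤ n && (n - n₀) % g == 0)

/-- The encoded realization `e` grows to one with multiplicities `a`, `b` and `c`. Multiplicities beyond
`A`, `2 * x` and `2 * (x + 1)` stand for residue classes modulo `1`, `x` and `x + 1`. -/
def covers (x A e a b c : ℕ) : Bool :=
  reaches 1 A (digit e 3) (digit e 0) a && reaches x (2 * x) (digit e 4) (digit e 1) b &&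
    reaches (x + 1) (2 * (x + 1)) (digit e 5) (digit e 2) c

/-- The multiplicities `a`, `b` and `c` may come from a triple to be realized: the conditions on
`v = a + b + c + 1` are imposed as far as they depend only on the residue classes that multiplicities
beyond their bounds stand for. For instance `v` modulo `x` does not change when `b` runs through its
residue class modulo `x`. -/
def required (x A a b c : ℕ) : Bool :=
  (A < a || 2 * x < b || 2 * (x + 1) < c || 2 * (x + 1) ≤ a + b + c + 1) &&
    (A < a || 2 * (x + 1) < c || (a + b + c + 1).gcd x == 1) &&
    (A < a || 2 * x < b || (a + b + c + 1).gcd (x + 1) == 1)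

/-- Every required triple of multiplicities, reduced to the range in which each residue class beyond a bound
occurs once, is covered by an entry of the table. The rows of the table are indexed by the residues of
`b - 1` modulo `x` and `c - 1` modulo `x + 1`. -/
def complete (x A : ℕ) (table : List (List ℕ)) : Bool :=
  (List.range (3 * x)).all fun b => (List.range (3 * (x + 1))).all fun c =>
    (List.range (A + 1)).all fun a => !required x A (a + 1) (b + 1) (c + 1) ||
      (table.getD (b % x * (x + 1) + c % (x + 1)) []).any fun e =>
        covers x A e (a + 1) (b + 1) (c + 1)

theorem distinct_sound (l : List ℕ) : ∀ k, distinct k l = true →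
    l.Nodup ∧ ∀ p ∈ l, k.testBit p = false := by
  induction l with
  | nil => intro k _; simp
  | cons p l ih =>
    intro k h
    simp only [distinct, Bool.and_eq_true, Bool.not_eq_true'] at h
    obtain ⟨hn, hk⟩ := ih _ h.2
    simp only [Nat.testBit_or, Bool.or_eq_false_iff] at hk
    refine ⟨List.nodup_cons.2 ⟨fun hp => ?_, hn⟩, ?_⟩
    · have := (hk p hp).2
      simp [Nat.testBit_shiftLeft] at this
    · rintro q hq
      rcases List.mem_cons.1 hq with rfl | hq
      · exact h.1
      · exact (hk q hq).1

theorem isRange_sound {n : ℕ} {l : List ℕ} (h : isRange n l = true) : l.Perm (List.range n) := by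
  simp only [isRange, Bool.and_eq_true, beq_iff_eq, List.all_eq_true, decide_eq_true_eq] at h
  refine (List.subperm_of_subset (distinct_sound l 0 h.2).1 fun p hp => ?_).perm_of_length_le ?_
  · exact List.mem_range.2 (h.1.2 p hp)
  · simp [h.1.1]

theorem mem_decode (x n : ℕ) : ∀ e, ∀ s ∈ decode x n e, s.2 = 1 ∨ s.2 = x ∨ s.2 = x + 1 := by
  induction n with
  | zero => intro e s hs; simp [decode] at hs
  | succ n ih =>
    intro e s hs
    rcases List.mem_cons.1 hs with rfl | hs
    · simp only [stepOfCode]; split_ifs <;> simp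
    · exact ih _ s hs

/-- The lengths by which the realization encoded by `e` is claimed to be growable. -/
def growths (x e : ℕ) : Finset ℕ :=
  (if digit e 3 = 0 then ∅ else {1}) ∪ (if digit e 4 = 0 then ∅ else {x}) ∪
    (if digit e 5 = 0 then ∅ else {x + 1})

theorem cutOk_sound {v m g : ℕ} {l : List Step} (h : cutOk v m g l = true) (hm : m ≠ 0) :
    ∃ k < v, (depths v k 0 l).Perm (List.range g) := by
  simp only [cutOk, Bool.or_eq_true, beq_iff_eq, Bool.and_eq_true, decide_eq_true_eq] at h
  rcases h with h | h
  · exact absurd h hm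
  · exact ⟨m - 1, by omega, isRange_sound h.2⟩

theorem card_triple (x a b c : ℕ) : (triple x a b c).card = a + b + c := by
  simp [triple]

theorem growable_of_valid {x e : ℕ} (hx : 1 < x) (h : valid x e = true) :
    Growable (growths x e) (triple x (digit e 0) (digit e 1) (digit e 2)) := by
  simp only [valid, Bool.and_eq_true, beq_iff_eq, decide_eq_true_eq] at h
  obtain ⟨⟨⟨⟨⟨⟨⟨hv, ha⟩, hb⟩, hc⟩, hd⟩, h1⟩, h2⟩, h3⟩ := h
  generalize digit e 0 = a at *
  generalize digit e 1 = b at *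
  generalize digit e 2 = c at *
  have hmem := mem_decode x (a + b + c) (e >>> 36)
  generalize decode x (a + b + c) (e >>> 36) = l at *
  refine ⟨0, l, ?_, ?_, ?_, ?_, ?_⟩
  -- The checked counts determine the multiset, since all lengths are `1`, `x` or `x + 1`.
  · ext n
    simp only [Multiset.coe_count, triple, Multiset.count_add, Multiset.count_replicate]
    by_cases hn : n ∈ l.map Prod.snd
    · obtain ⟨s, hs, rfl⟩ := List.mem_map.1 hn
      rcases hmem s hs with h | h | h <;> rw [h]
      · rw [ha, if_pos rfl, if_neg (by omega), if_neg (by omega)]; omega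
      · rw [hb, if_pos rfl, if_neg (by omega), if_neg (by omega)]; omega
      · rw [hc, if_pos rfl, if_neg (by omega), if_neg (by omega)]; omega
    · have h0 := List.count_eq_zero.2 hn
      rw [h0]
      split_ifs <;> subst_vars <;> omega
  · omega
  · intro n hn
    rw [card_triple]
    simp only [triple, Multiset.mem_add, Multiset.mem_replicate] at hn
    omega
  · rw [card_triple]; exact (distinct_sound _ _ hd).1
  · intro g hg
    rw [card_triple]
    simp only [growths, Finset.mem_union] at hg
    rcases hg with (hg | hg) | hg <;> split_ifs at hg with h0 <;> simp at hg <;> subst hg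
    exacts [cutOk_sound h1 h0, cutOk_sound h2 h0, cutOk_sound h3 h0]

/-- The representative of `n` for the purpose of coverage: `n` itself up to `N`, and beyond `N` the member
of its residue class modulo `g` in `N + 1, …, N + g`. -/
def clamp (g N n : ℕ) : ℕ := if n ≤ N then n else N + 1 + (n - (N + 1)) % g

theorem reaches_clamp {g N m n₀ n : ℕ} (h : reaches g N m n₀ (clamp g N n) = true) :
    ∃ k, n = n₀ + k * g ∧ (k = 0 ∨ m ≠ 0) := by
  simp only [reaches, Bool.or_eq_true, Bool.and_eq_true, beq_iff_eq, decide_eq_true_eq, bne_iff_ne] at h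
  unfold clamp at h
  split_ifs at h with hn
  · rcases h with h | h
    · exact ⟨0, by omega, Or.inl rfl⟩
    · obtain ⟨k, hk⟩ := Nat.dvd_of_mod_eq_zero h.2
      exact ⟨k, by rw [mul_comm]; omega, Or.inr h.1.1⟩
  · rcases h with h | h
    · omega
    · obtain ⟨k, hk⟩ := Nat.dvd_of_mod_eq_zero h.2
      have := Nat.mod_add_div (n - (N + 1)) g
      refine ⟨k + (n - (N + 1)) / g, ?_, Or.inr h.1.1⟩
      rw [add_mul, mul_comm k, mul_comm _ g]
      omega

theorem Growable.mono {G H : Finset ℕ} {L : Multiset ℕ} (h : Growable G L) (hH : H ⊆ G) :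
    Growable H L := by
  obtain ⟨p, l, h1, h2, h3, h4, h5⟩ := h
  exact ⟨p, l, h1, h2, h3, h4, fun g hg => h5 g (hH hg)⟩

/-- An encoded realization that covers the reduced triple grows to the triple itself. -/
theorem growable_of_covers {x A e a b c : ℕ} (hx : 1 < x) (hv : valid x e = true)
    (h : covers x A e (clamp 1 A a) (clamp x (2 * x) b)
      (clamp (x + 1) (2 * (x + 1)) c) = true) :
    Growable ∅ (triple x a b c) := by
  simp only [covers, Bool.and_eq_true] at h
  obtain ⟨i, rfl, hi⟩ := reaches_clamp h.1.1
  obtain ⟨j, rfl, hj⟩ := reaches_clamp h.1.2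
  obtain ⟨k, rfl, hk⟩ := reaches_clamp h.2
  have key : ∀ {L : Multiset ℕ} {g n : ℕ}, Growable (growths x e) L →
      (n = 0 ∨ g ∈ growths x e) →
      Growable (growths x e) (L + Multiset.replicate (n * g) g) := by
    rintro L g n hL (rfl | hg)
    · simpa using hL
    · exact hL.grow_iter hg n
  have h0 := growable_of_valid hx hv
  have h1 := key (g := 1) (n := i) h0 (hi.imp id fun h => by simp [growths, h])
  have h2 := key (g := x) (n := j) h1 (hj.imp id fun h => by simp [growths, h])
  have h3 := key (g := x + 1) (n := k) h2 (hk.imp id fun h => by simp [growths, h])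
  convert h3.mono (Finset.empty_subset _) using 1
  simp only [triple, Multiset.replicate_add]
  abel

theorem clamp_le_iff {g N n : ℕ} : N < clamp g N n ↔ N < n := by
  unfold clamp
  split_ifs <;> omega

theorem clamp_of_le {g N n : ℕ} (h : ¬ N < n) : clamp g N n = n := by
  unfold clamp
  rw [if_pos (by omega)]

theorem clamp_le {g N n : ℕ} (hg : 0 < g) : clamp g N n ≤ N + g := by
  have := Nat.mod_lt (n - (N + 1)) hg
  unfold clamp
  split_ifs <;> omega

theorem clamp_pos {g N n : ℕ} (hn : 0 < n) : 0 < clamp g N n := by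
  unfold clamp
  split_ifs <;> omega

theorem clamp_modEq (g N n : ℕ) : clamp g N n ≡ n [MOD g] := by
  unfold clamp
  split_ifs with h
  · rfl
  · have : n = N + 1 + (n - (N + 1)) := by omega
    conv_rhs => rw [this]
    exact Nat.ModEq.add_left _ (Nat.mod_modEq _ _)

theorem required_clamp {x A a b c : ℕ} (hv : 2 * (x + 1) ≤ a + b + c + 1)
    (h1 : Nat.Coprime (a + b + c + 1) x) (h2 : Nat.Coprime (a + b + c + 1) (x + 1)) :
    required x A (clamp 1 A a) (clamp x (2 * x) b) (clamp (x + 1) (2 * (x + 1)) c) = true := by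
  simp only [required, Bool.and_eq_true, Bool.or_eq_true, decide_eq_true_eq, beq_iff_eq,
    clamp_le_iff]
  by_cases ha : A < a
  · simp [ha]
  rw [clamp_of_le ha]
  refine ⟨⟨?_, ?_⟩, ?_⟩
  · by_cases hb : 2 * x < b
    · simp [hb]
    by_cases hc : 2 * (x + 1) < c
    · simp [hc]
    rw [clamp_of_le hb, clamp_of_le hc]
    exact Or.inr hv
  · by_cases hc : 2 * (x + 1) < c
    · simp [hc]
    rw [clamp_of_le hc]
    refine Or.inr ?_
    have : a + clamp x (2 * x) b + c + 1 ≡ a + b + c + 1 [MOD x] :=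
      (((clamp_modEq x (2 * x) b).add_left a).add_right c).add_right 1
    rw [this.gcd_eq]
    exact h1
  · by_cases hb : 2 * x < b
    · simp [hb]
    rw [clamp_of_le hb]
    refine Or.inr ?_
    have : a + b + clamp (x + 1) (2 * (x + 1)) c + 1 ≡ a + b + c + 1 [MOD (x + 1)] :=
      ((clamp_modEq (x + 1) (2 * (x + 1)) c).add_left (a + b)).add_right 1
    rw [this.gcd_eq]
    exact h2

theorem growable_of_complete {x A : ℕ} {table : List (List ℕ)} (hx : 1 < x)
    (hvalid : (table.all fun t => t.all (valid x)) = true)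
    (hcomplete : complete x A table = true) {a b c : ℕ} (ha : 0 < a) (hb : 0 < b) (hc : 0 < c)
    (hv : 2 * (x + 1) ≤ a + b + c + 1) (h1 : Nat.Coprime (a + b + c + 1) x)
    (h2 : Nat.Coprime (a + b + c + 1) (x + 1)) : Growable ∅ (triple x a b c) := by
  have hreq := required_clamp (A := A) hv h1 h2
  simp only [complete, List.all_eq_true, List.mem_range] at hcomplete
  have hb1 := clamp_le (g := x) (N := 2 * x) (n := b) (by omega)
  have hc1 := clamp_le (g := x + 1) (N := 2 * (x + 1)) (n := c) (by omega)
  have ha1 := clamp_le (g := 1) (N := A) (n := a) (by omega)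
  have hb0 := clamp_pos (g := x) (N := 2 * x) hb
  have hc0 := clamp_pos (g := x + 1) (N := 2 * (x + 1)) hc
  have ha0 := clamp_pos (g := 1) (N := A) ha
  have := hcomplete (clamp x (2 * x) b - 1) (by omega)
    (clamp (x + 1) (2 * (x + 1)) c - 1) (by omega) (clamp 1 A a - 1) (by omega)
  rw [Nat.sub_add_cancel hb0, Nat.sub_add_cancel hc0, Nat.sub_add_cancel ha0, hreq] at this
  simp only [Bool.not_true, Bool.false_or, List.any_eq_true] at this
  obtain ⟨e, he, hcov⟩ := this
  have hmem : ∃ t ∈ table, e ∈ t := by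
    rw [List.getD_eq_getElem?_getD] at he
    rcases h : table[(clamp x (2 * x) b - 1) % x * (x + 1) +
      (clamp (x + 1) (2 * (x + 1)) c - 1) % (x + 1)]? with _ | t
    · rw [h] at he; simp at he
    · rw [h] at he; exact ⟨t, List.mem_of_getElem? h, he⟩
  obtain ⟨t, ht, het⟩ := hmem
  exact growable_of_covers hx (List.all_eq_true.1 (List.all_eq_true.1 hvalid t ht) e het) hcov

/-- A multiset with support `{1, x, x + 1}` is determined by three multiplicities. -/
theorem eq_triple {x : ℕ} (hx : 1 < x) {L : Multiset ℕ} (h : L.toFinset = {1, x, x + 1}) :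
    L = triple x (L.count 1) (L.count x) (L.count (x + 1)) := by
  ext n
  simp only [triple, Multiset.count_add, Multiset.count_replicate]
  by_cases hn : n ∈ L
  · have : n ∈ ({1, x, x + 1} : Finset ℕ) := h ▸ Multiset.mem_toFinset.2 hn
    simp only [Finset.mem_insert, Finset.mem_singleton] at this
    rcases this with rfl | rfl | rfl
    · rw [if_pos rfl, if_neg (by omega), if_neg (by omega)]; omega
    · rw [if_pos rfl, if_neg (by omega), if_neg (by omega)]; omega
    · rw [if_pos rfl, if_neg (by omega), if_neg (by omega)]; omega
  · have h0 := Multiset.count_eq_zero.2 hn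
    rw [h0]
    split_ifs <;> subst_vars <;> omega

theorem isRealizable_of_complete {x A : ℕ} {table : List (List ℕ)} (hx : 1 < x)
    (hvalid : (table.all fun t => t.all (valid x)) = true)
    (hcomplete : complete x A table = true) {v : ℕ} {L : Multiset ℕ} (hL : IsBHRInstance v L)
    (hU : L.toFinset = {1, x, x + 1}) (hv : ∀ l ∈ ({1, x, x + 1} : Finset ℕ), Nat.Coprime v l) :
    IsRealizable v L := by
  have hpos : ∀ n ∈ ({1, x, x + 1} : Finset ℕ), 0 < L.count n := fun n hn =>
    Multiset.count_pos.2 (Multiset.mem_toFinset.1 (hU ▸ hn))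
  have heq := eq_triple hx hU
  have hcard : L.card = L.count 1 + L.count x + L.count (x + 1) := by
    conv_lhs => rw [heq, card_triple]
  have hy : x + 1 ≤ v / 2 :=
    (Finset.mem_Icc.1 (hL.2 (hU ▸ (by simp : x + 1 ∈ ({1, x, x + 1} : Finset ℕ))))).2
  have hv' : v = L.count 1 + L.count x + L.count (x + 1) + 1 := by
    rw [← hcard, hL.1]
  have hg : Growable ∅ L := by
    rw [heq]
    refine growable_of_complete hx hvalid hcomplete (hpos 1 (by simp)) (hpos x (by simp))
      (hpos (x + 1) (by simp)) (by omega) ?_ ?_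
    · rw [← hv']; exact hv x (by simp)
    · rw [← hv']; exact hv (x + 1) (by simp)
  exact hg.isRealizable hL

theorem burattiHoldsFor_of_coprime {U : Finset ℕ}
    (h : ∀ (v : ℕ) (L : Multiset ℕ), IsBHRInstance v L → L.toFinset = U →
      (∀ l ∈ U, Nat.Coprime v l) → IsRealizable v L) : BurattiHoldsFor U := by
  intro v hv L hL hU
  refine ⟨fun _ => bhrCondition_of_prime hv hL, fun _ => h v L hL hU fun l hl => ?_⟩
  have hl := Finset.mem_Icc.1 (hL.2 (hU ▸ hl))
  exact Nat.coprime_of_lt_prime (by omega) (by have := hv.pos; omega) hv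

/-! ### Support {1, 7, 8} -/

/-- Encoded growable realizations of multisets with elements in `{1, 7, 8}`, grouped by
multiplicities as described at `complete`. -/
def table7 : List (List ℕ) := [
  [0x38326e632b24053009201, 0x93ca0838c190100013c1, 0xe0e42d604b001202, 0x80754d6730b009042,
   0x4e53d4fb30a001203, 0x4961fb34ae2288053009204, 0x150c20f350e2fff280011044,
   0x167264887245d6c057449205, 0x5268e18438c4900e1c13c5, 0x193fec27c5a2890c9046,
   0x14ecfed3a36000201207, 0x835e8986f300008104e],
  [0xd0dfea12c8002201, 0xcfd399d1effff448012041, 0x4da01fbe04d002202, 0x312befa18463fa20700a203,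
   0x16a41b506922bff240012043, 0x122ea2846698e6a2c900a204, 0x45c80439140ccc0070023c4,
   0x657178fd604e202205, 0x28e23b0c7b614000a045, 0x1b827339f63814044a047, 0x835feec48400004204d],
  [0x2d9c91be04c003201, 0x46d5ccfc3221700c200b202, 0x19ed2bdf9accccc58e013042,
   0x1281a8917cc430e05700b203, 0x2324a83e0a2c460020033c3, 0x6ac40b6be8e689d51208b204,
   0x739c2b5d100a003204, 0x51c0153c3408000b044, 0xe43f506f770090c3205, 0x4ebeacb90da424704b046,
   0x25a1ab830b600004304c],
  [0x4995f74df5e84405500c201, 0x1c85b5a65dcccc7400014041, 0x1d36b3542aa889224700c202,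
   0x2ec34adeffc5b50120043c2, 0x1be6886976c05100c043, 0x25bc8aa6e7009004203,
   0x1b43ceab2b204e004204, 0x850f4f3eb9738b144205, 0x5aff9f2ca03024000c045,
   0x8f7cc8bc8e4f128044c047, 0x1cbcc291d8700008404b],
  [0x1d2710b5f412a0949000d201, 0x32029b4d4fd68900f0053c1, 0x1d95f145fe005100d042,
   0x37f5219ae2004005202, 0x18f82bba0aa051005203, 0x75d0eca89d68f33e05a20d204,
   0x7760288eb9700b145204, 0x5b834437c64610000d044, 0x956cbf7b2361928050d046,
   0x1d80281e30400030504a],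
  [0x290d740fe3605000e041, 0x421720c0f0001006201, 0x18a83df21a3248006202,
   0x38dfe60db59c14400e043, 0x1902c4004006043, 0x38249656cce0248006204, 0x150ddae7d93735111c6205,
   0x246b6165240006045, 0x191de1cf8db1f1204e20e047, 0x224649c2f440002c6049],
  [0x99893a04a007041, 0x1148d83288007042, 0x1533f4aa04b007043, 0x728a189404d007044,
   0x64c2499406b300553c7205, 0x1ca7e540d6d090c05744f046, 0x1c57cf33669000347048],
  [0x392157404a008041, 0x1119152804c008042, 0x7f2d03840c1008043, 0x12ad666065606af4124647450204,
   0x45d98eb3269b56006588205, 0x1c85b5a6390ad46056010045, 0x4b9321f8241c0448047],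
  [0x81a847b004d009081, 0x24f27b923766301001401, 0x45d6b9da04b001242, 0x4963ee9f038721248009243,
   0x1d394e73b7db2681c0011083, 0x71fb201379635af515a14d6c9404, 0x5e316aa68241c240589244,
   0x2ec2ec9a2a77b4001001404, 0x260a8d5ba604e201245, 0x242bae37e67300089085,
   0x31435849e00001c108d],
  [0x3103f3be04b002241, 0x306040e1ce620f38c00a242, 0x19cd195cee4b2a4280012082,
   0x3bdbada113bd0c05700a243, 0x82785b42d9d62001002403, 0x3439c6f217b4e1d51208a244,
   0x326f0595f2006002244, 0x1c8232c051005000a084, 0x101461f396200b142245,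
   0x4ebeacdf4bfb2c008a086, 0x70726bae0002c208c],
  [0x33c28ae910c62c05500b241, 0x1b709ad6f1ccc01240013081, 0x1a966280eb7e05328800b242,
   0x1f5ea62199e3f6004003402, 0x23009b3ccf005100b083, 0x37f1a0961b00d003243,
   0x13acdf903ab56ba361714b244, 0x24cb8260ed2005003244, 0x932bec31f6d008083245,
   0x3fc43084c90c14044b085, 0xf23452b00028308b],
  [0x1a934200564337a0c100c241, 0x479b8108a899b8009004401, 0x26888185a5605100c082,
   0x421720d08c009004242, 0xbea4ce8029348004243, 0x1d82fd876783479e05a20c244,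
   0xdcb3acf7936006484244, 0x1bb3f32f405448700c084, 0x89b3290357ea41c054c086,
   0x257ad13a27c00014408a],
  [0x290a799a3e005100d081, 0x2bf677cad6003005241, 0x2ca7121c6005082, 0x38ca17a04b005083,
   0x1104785a04c005084, 0x254db76530b145085],
  [0x97dd4c04a006081, 0x3990f8a04b006082, 0x154bc86804c006083, 0x2c4001ba57c7073395d2086404,
   0x6ec207540c0006084, 0x81089ea50da074800c6245, 0x1c8518a26e72e832c010e086,
   0xc502dabdd8000306088],
  [0x3564a2404b007081, 0x13170d3004c007082, 0x5daace9204d007083, 0x1370ce038ebdf76d7605b507404,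
   0xbef40953afa12440107244, 0x14e795c5ce4015544000f085, 0x25a75cc2b23300147087],
  [0x156c5884101008081, 0x79c104e62ca008082, 0x2f7abc9d01c5008083, 0x6525e5aab56ae60d0010084,
   0x38e33e44ac8ee600d008244, 0x132a9802a9f23b15c8388245, 0x20d3a34b3f60d12c8086],
  [0x4e540e5b308001281, 0x4919d0eff55c8c055009282, 0x144692806870cc75c00110c2,
   0x1b6a667c94375e938d009283, 0x1f2c9dbc25ec2d008001443, 0x3414da3b0ebbece058209284,
   0x2bc7333ac2002001284, 0x286305dda161800090c4, 0xa865100ec600a441285, 0x4d4b0532dbb81404090c6,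
   0x84484b76dc0000410cc],
  [0x33d61822108d3c38100a281, 0x15ead97c91cbf681000120c1, 0x122b8654fe2b6ac05700a282,
   0x2ec2e472f88899014002442, 0x19e7a8659d60c200a0c3, 0x441cb425fe001002283,
   0x224955b5c4134b002284, 0x5650e158fcc051242285, 0x3fc5915d964924040a0c5, 0xfd3e3dae60004420cb],
  [0x13011f250614be549100b281, 0x2ec2ec9a3d46d9010003441, 0x2545c30dbc418400b0c2,
   0x41a4b191b0002003282, 0x1656dad0266101003283, 0x1676d31325798064965618b284,
   0x19dfb270080030c4, 0x4ee1dac6353128800b0c4, 0x793dc8f00c1830c5, 0x9bc240853507124050b0c6],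
  [0x25500c6cbff44d00c0c1, 0x421720d338005004281, 0x2ca6d41850040c2, 0x5c117684ab3f4d100c0c3,
   0x4782c60010040c3, 0x2b248933988f5d33205b1cc284, 0x569991ab7c04001384284,
   0x21cd26b599a5154020c0c5, 0x25e85e533f40001840c9],
  [0x16b16990054051005281, 0x345ab1004b0050c2, 0x66a95100c10050c3, 0x2573e75204d0050c4,
   0xff52cf4493d4055245285, 0x8b44570b09d6761c05cd0c6, 0xa8b4a3df220001450c8],
  [0x390baa00c20060c1, 0xe5ca5aa04b0060c2, 0x47a91e2804d0060c3, 0x16a4f660ffceb3bc8205a28e284,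
   0x2d9a93ec7679960034c6285, 0x16ffccc2d3fa27805640e0c5, 0x1cccdc78fa50001860c7],
  [0x151f6c0c0c20070c1, 0x80530b7730b0070c2, 0xe72c51501c60070c3, 0x1313f7bad33090c28900f0c4,
   0x88d28b37d6744ad77600e747444, 0x341587fd02a3bf015848f0c5, 0x970c570bd5f992000207285,
   0x5fbaa1bb8d0001c70c6],
  [0x8182ab0c08d0080c1, 0xe84ec8fb3080080c2, 0x1a857f652251ccc3ce0100c3,
   0x1e88449e502c03008008283, 0x2beaca6df1c258cfd6741d2710284, 0xb6304eb5cb61ea00f148284,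
   0x1fc352b60f60c03080c5],
  [0x4963eee836849e2470092c1, 0x1761764618e85c3240011101, 0x122ea35698c4b2f2880092c2,
   0x1f2c8ef3e1be79010001482, 0x16bbe3990f0051009103, 0x37f197cce100f0012c3,
   0x1d82ef9c60d62ab80594c92c4, 0x106960e496a04f0012c4, 0x3e73fa8beca00a4012c5,
   0x667f782f958180409105, 0x9bb6ece0b00044110b],
  [0x1b707776273d3de3ce00a2c1, 0x1f2c9dbc34482900d002481, 0x1b5721b39f804e00a102,
   0x3b9bf8afa604c0022c2, 0x14f910d71e344e0022c3, 0x5029b6e5bcda24700a104, 0x143757c001002104,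
   0x242bd469ad5204d1c22c5, 0xc3b81c658b1ef55420a106, 0x8cece9475f0002c210a],
  [0x20c8d89904205000b101, 0x2bcb3819260020032c1, 0x19e46a066c630b0032c2, 0x1094627289003103,
   0x7b9c3f63a517429576171cb2c4, 0x1437570001003104, 0x254b045d30b143105],
  [0x18f953ea7320510042c1, 0x36457c4144004102, 0x13de066a103004103,
   0x2930703cea4b98fb1605c58c2c4, 0x146df0f578bba0013c42c4, 0xa2955a67bf5c014048c104,
   0x1cdc3b62c46000384108],
  [0x53f17d90fcf20d200d101, 0x1f7fecc002005101, 0x66adbca246005102, 0x7f88b9da04d005103,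
   0x22d5101467723a67a6541345484, 0x3beb4d966dabc3005052c4, 0x12e8a7897cc364a28004d105,
   0x1ccd362d3a90002c5107],
  [0x1516e4d8081006101, 0x57c4000004d006102, 0x6a365eec4935a0c10062c3, 0xe2a0f5fa1ea43005700e104,
   0x27d448c1a4a75b00e0062c4, 0x8bd1b2edf11ee40572462c5, 0x1aa88c52c381403c6106],
  [0x79c6921004d007101, 0x2c512f39e04e007102, 0x1d36b35a06083141cf00f103,
   0x3cd3e9e882f83b00a0072c3, 0x1a93395878bbf764430072c4, 0x6e5beadb7287a964c32c72c5,
   0x242baf043ef280087105],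
  [0x2f7b3db50181008101, 0x9619305a7fef881d0010102, 0x2ec33f0fd6214300f0082c2,
   0x1b50051a9625afb3d70082c3, 0x230f2f45fc404f008104, 0xaa0b2b41720052308105],
  [0x1a88db0e14d1cda056009301, 0x32023d087d999900f0014c1, 0x1e7889152f0051009142,
   0x400ff870b900c001302, 0x15f8817093940e001303, 0xf044235b894f1249656189304,
   0x15c24e6006001144, 0x297439359f160c0389144, 0x783aa5f00c181145],
  [0x28a23b6284c05100a141, 0x41b20234b8001002301, 0x63efe204a002142, 0x5402f7a8b60834b00a143,
   0x23dbf7c001002143, 0x6372b66081002144, 0x5d54ee5700a102145, 0xbc9c7a88daa6134c08a145],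
  [0x26611be7a46182003301, 0x364cf76185003142, 0x377549d43256053003303,
   0x11cbc1b4f3a581bac876171d3144, 0x2d86143f00d003144, 0x516721cb805d604e203305,
   0x1509bedbc7133850001cb146, 0xa864f16f5e000303148],
  [0x2a176ba04b004141, 0xbf94e6804c004142, 0x53ed1f9b34b004143, 0xb401326770adff4a1555208c304,
   0x2fd71f31d3a14a004504305, 0x16a00db688db33124054c145, 0x2a2da3fcb000084147],
  [0x13fcf60c0c1005141, 0x745347f204d005142, 0x704e062a65a9a081005303,
   0x16ffccc30aa46920571cd144, 0x2a1be4bc29a4c2001005304, 0xd67c2e7724814e00e5c5305,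
   0x1916e64b017000185146],
  [0x7a43f85a143006141, 0x678993790f8ec055006302, 0x1a59cb56d5912a405600e143,
   0x496c13f2bec88900e006303, 0x6b16979f3d572075130ce144, 0x1310d446d20b0a60024c6304,
   0xfddb7d3d9a000206145],
  [0x2fef075ca181007141, 0x1a88a693858f0cc21500f142, 0x2e29bf34605d2d008007302,
   0x12256cc18d82bc6405007303, 0x19153f6980e286007144, 0xdfa162b5fa23cc187145],
  [0x1d39d3dfa871448546010141, 0x2434cc693fd28e00c008301, 0x11861087c6a21c92c8008302,
   0x22f1538b40a0c1008143, 0x1ff028c3d1d5ae9a0594c8304, 0xaa0b2b3e324140448145],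
  [0x289b760374a050009181, 0x2bca045066001001341, 0x18a1c8ddb66289001342,
   0x3275d31e7c00204009183, 0x144162900a001183, 0x10915f23b3e2e2647e05c211184,
   0x17fdc8874672f00d0c9184, 0xba3fb2b008001184, 0x858dfb900b141185],
  [0x708dd604a002181, 0x229ac6a04a002182, 0x6378f99288002183, 0x1aa8f03df426a02a7605c58a344,
   0x508ab3d804d002184, 0x799c2fa059eae001282346, 0x11fe08112da01cb3400ca186,
   0x10154743098000342188],
  [0x39a4ecf005fa49000b181, 0x246f776006003181, 0x13de32441c5003182, 0x795f242804d003183,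
   0x888c1c8ab6ea38df9e05a20b344, 0x14981708f1d6a6009443345, 0x1c858eca49287d650020b185,
   0x24c859a58cc000403187],
  [0x143762c8081004181, 0x77c44c641c6004182, 0x7e717de62d82a44f004343, 0xd1dc2d1a7159023c100c184,
   0x1e865a760009fd00f004344, 0x12ae51374dd9de4442244345, 0x1b43917525734c0c4186],
  [0x7fa3242c081005181, 0x8168f6860e561288005342, 0x1a9254cf271241e18e00d183,
   0x2a928d90894f24005005343, 0x341587fd0719ece05820d184, 0xe2a043b3332485009085344,
   0xbf51c14f140003c5185],
  [0x7e717dece4b7a0c1006341, 0x1282772dd6bbb0b24800e182, 0x14da044043331c006006342,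
   0x119a6c74e8c096a054006343, 0xd76ddee0a2bece058206344, 0x4079c3d24a06675d3c01ce184,
   0x2a4f407140000386184],
  [0x103c7bd05a52bfc04f00f181, 0x4cc61bb762159900c007341, 0x1a933e474610182442007342,
   0x197cf5c4dd038c007183, 0x2ffe98660f62c21c059247344, 0x516b62db35dd280087185],
  [0x11231d9817c3e0a0c1008341, 0x1468de5232c051008182, 0xa1d13594df804d008183,
   0x139e920e7c69a1ece058208344, 0x426809e4cd681c0488184],
  [0x3cf21e04a0011c1, 0x21be14e1030011c2, 0x3158d55321a6101001383, 0x22117814d9b3beaca25c53c9384,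
   0x45d524da04d0011c4, 0xd906fa76a63b0112c1386, 0x7d177c735d4a554400891c6,
   0x1033f36687e0001811c8],
  [0x22999672c90021c1, 0xb0ed71a04c0021c2, 0x54413e5b34c0021c3, 0x12e9ddde82f40bfc96d55208a384,
   0x1ee1bba672844900d1c2385, 0xd1d148d5af82141c05ca1c5, 0x139da3f11490000c21c7],
  [0x79a1aee04c0031c1, 0x790f3be22060031c2, 0x79d0710359dd6055003383, 0x16e758700ec26920571cb1c4,
   0x2a507c52ddd20b009003384, 0x5247fe1ce600e2031c5],
  [0x7fc74fe804c0041c1, 0x553be5ede0d2e055004382, 0x8bddd5515ea02c3cc00c1c3,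
   0x1f34f4bdec60a900d004383, 0x892d52baf1d46ce05820c1c4, 0xc1d8287fb0aea9015144384,
   0x1db6e6976e50000c41c5],
  [0x7d79cedd79756055005381, 0x13013561c3fe71b28900d1c2, 0x23f03ed77230e400c005382,
   0x442507a70a0500051c3, 0x6ac41d05cedda9d4d2085384, 0x12ef1e721460c03051c4],
  [0x1a59e580fbcba5205600e1c1, 0x49254ae5be39b8009006381, 0x1189673ccf96cd92c8006382,
   0x197b7833e461430061c3, 0x1ff028c3d1d872ca0594c6384, 0x47774d20a1041403861c5],
  [0x44254e21d004f0071c1, 0x19eec72ed020500071c2, 0x9331831492c3ce0071c3,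
   0x3971ba745cda3070071c4, 0x17fdc85e517c404f2471c5],
  [0x24e2c320abe0500081c1, 0xa1db341b34a0810081c2, 0x43db70c308fc0520081c3,
   0x328b343f4ff797a9276991d01c4, 0x10984f121401d00c1881c4]]

theorem valid_table7 : (table7.all fun t => t.all (valid 7)) = true := by decide +kernel

theorem complete_table7 : complete 7 13 table7 = true := by decide +kernel

/-! ### Support {1, 9, 10} -/

/-- Encoded growable realizations of multisets with elements in `{1, 9, 10}`, grouped by
multiplicities as described at `complete`. -/
def table9 : List (List ℕ) := [
  [0x4ded8a2530a001281, 0x1fa02a5ca04e001282, 0x6bd9a0590410200b043, 0x47283253d604f001284,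
   0x202d44b9ca014000b044, 0xf70379c4da051001285, 0x326d89c8cd35d54dd255300b286,
   0x14bd1a7df64c7be3ff4100015046, 0x22d4d074c6097ed2de4c12414c7, 0x143c4e8544b6e28049650028b287,
   0x3b8acf60e2fd40c03cb048, 0x11186f9488c7ce200f0c128b, 0x1cdd75ba013330003c1052],
  [0x2382e4b6604c002281, 0xac27783fa0c1002282, 0x1f9f171d1938a002283, 0x201e977103330000c043,
   0x1ab1c6ddece206002284, 0x3267fd71549d4424a405a00c285, 0x12afd5241854607ff56549016045,
   0xe3ffa2e3934b4d869805b00c286, 0x214bd76a5caf5626dc0070024c6, 0x2018d9c40fd6052282287,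
   0xcef94abcc394418000c047, 0x1740a4924c2dc532c05cc049, 0xf965761d09f83000502052],
  [0x777261cda04e003281, 0x6621559244247003282, 0x20d23d3b74c05100d042, 0x18c8981586738b003283,
   0xf65a9ea20370a7bda05b00d284, 0x14cdeff5d586c2f7ff405d017044, 0x125f154a77d1e8e787e0d000d285,
   0x1cbb0e4aa139bff5960010034c5, 0x12d8130e813264d1003286, 0x95a2c82a8856020000d046,
   0x957f80db3fffc0532c3287, 0x18ea548d831806a30b0cd048, 0x5d8d91da616333000403052],
  [0x295c821c3e04f004281, 0x290d4401f4c05100e041, 0x188fb8475be051004282,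
   0x214a7f7be7ad30c4bc18400e283, 0x14ce6b16625dad51c9205d018043, 0x10601694462bfa8a4b205c00e284,
   0x39f314aec11ada5f90170044c4, 0x179db0254f0d6052004285, 0xb132e6f30a23605400e045,
   0x7f632a2de27a4055004286, 0x48d3b0b40c7d6052284287, 0x1d1b31f3bc8f87018000e047,
   0x9061ccd45515133224c01ce04b, 0x5ee4da0e8c1419000284051],
  [0x1af83444f1130b005281, 0x230ec43bda3bf2cdba0c200f282, 0xf9ad050de97c4d07ff480019042,
   0x1343de6708c6821182a10100f283, 0x20dd62961d72b9d2d101c0054c3, 0x90534bffc047605400f044,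
   0x14cde2dcba632009005284, 0x6f365836c71c9512005285, 0xab2be7b03ff6efeaec1a6da10f286,
   0x1b15034fa1f0a500a085286, 0x1d1b31f3bdabea53c000f046, 0x29854747ce29a226009b34f04a,
   0x40a86add71c70005c5050],
  [0x328c9caf09f394240b695010281, 0x14ce6b167f30fffff6355301a041, 0xc8fa50d47a9eb0846c34b010282,
   0x15fc3c8ba14b1a14cc4410064c2, 0x8d3e889e134cc055010043, 0x14e939bfd24f0001006283,
   0x886d223053612054006284, 0x1d1bce132e0e26c0c2010045, 0x1d94cc8f79b6de008006285,
   0x13d2616da1403c2057006286, 0x31359e5163449c40532c6287, 0x662695e83c4fd44f12c0550049,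
   0x65bffca7fa8ed700024604f],
  [0xda521cc645de47dccc510011281, 0x165521c56bd23c674d00a0074c1, 0xcfce0eb830fb03c9011042,
   0x158fcf1250e70007007282, 0x815daff4f06b4094007283, 0x1caf464e7cedc66097011044,
   0x3913b1200b007044, 0x19ec9a7084a88be102007285, 0x4fc4b13ead63f04058007286,
   0x2977196fd29faec6059007287, 0x2bf22abd7a350d05605b4d1048, 0xb38dabc38009047048],
  [0xb17cf6fd2cccc0c1012041, 0x14e95166a68f0001008281, 0xbce30a9fdc1fa2c9008282,
   0x192aacb57fd320c057012043, 0xf7d5c0c002008043, 0x197fb7d235d07fe1c6008284,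
   0x324119ff4318b74081008285, 0x303a42c972d34154058008286, 0xd2f24389a0ed612b595248287,
   0x1d9e45bcb22340008047, 0x144e2d76eb77c4fc5056c0492049, 0x19c01b3804d029800048804d],
  [0x67cb6ac0c2009041, 0x7299fa0c04d009042, 0xe95766a4143009043, 0x56b5cc38338c009044,
   0x6240c13512050009045, 0xc3190f7ea330a009046, 0x4b967abf60f4c8e2148e189287,
   0x62e0e02a52f75d30a40c05d3048, 0x1502d5224f2443800004904c],
  [0x1d3966672e7ffff554014041, 0x8024ffff00a00a041, 0x26c7c409c04e00a042, 0x11ce0a3b8414400a043,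
   0x4c05877caa04f00a044, 0x2840a0af95405000a045, 0x376b75abc32070caaf46b261d484a4c6,
   0x47b4ebf01ab981e581c050a286, 0x631efd44289e2f7dfe380014047, 0x9569708811fdc0542ca049],
  [0x118918b9d59b1da053001501, 0x9d50c8a2604f0012c2, 0x243320cf42805000b083,
   0x381f3e048c0050012c3, 0x161870949da04f0012c4, 0x18e124ab76dbdf51b005c00b2c5,
   0x11c2164a318fcc9d4ee540015085, 0x11c2d42ec0c9a77af1938a00b2c6, 0x1e48e5891c2a5352a1553001506,
   0xc0951a985ba60522812c7, 0xc31281b055aa33c00cb087, 0x2fa09ba69965b30000c1092],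
  [0x6d673041cc04f00c081, 0x4169eecf1a0500022c2, 0x290a79de93205100c082, 0x1ab1d8844db3cd0022c3,
   0x917d8be468947411a05b00c2c4, 0x6ef78f4bbc7f9807e605d016084, 0x1341a1dbefa58a6f6f755400c2c5,
   0x165521c56bd0319e6e001002505, 0x154145442bba60520022c6, 0x96d1206f012b40c000c086,
   0x3c5565357ff0af37eca05e582507, 0x5628109ae49e62404c22c7, 0x135d3b7df4b17242405cc088,
   0x369a65fcb978400004c2092],
  [0x295c82125a04e0032c1, 0x290a7ab703d3c000d081, 0x18cb92830e62070032c2,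
   0x20774b8187ef04c98b6da00d2c3, 0x104ec60f2e172bfff8a300017083, 0x58dc12f29ee6484db215c00d2c4,
   0x1c73d27d616ef33596012003504, 0x14cbc4be9b08534a0032c5, 0xc30fbc3f6292b50000d085,
   0xb4ca9f3a2f8d338d0032c6, 0x2f68d73190f6624ce1832c7, 0x16fff317a4fe4381404cd087,
   0x2998cf56afce00000043091],
  [0x1ab1d9091ad34a0042c1, 0x36eaf9d3b37a16045349000e2c2, 0x127e9813ff47ff21e0775c018082,
   0xf170b1768e4d9dc24c05d00e2c3, 0x16551740bcb99a464900d004503, 0xa62f546c4023405500e084,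
   0xbed546916b380010042c4, 0x49122d182c8720540042c5, 0x144bb09ffc01efc05700e086,
   0x45d4c9208179360085842c6, 0x198e2bf390767241c60042c7, 0x3371405fc81ec54605944e088,
   0x1f27a7a9b253000144090],
  [0x23a39331ba8e85dae005a00f2c1, 0x989466a4fa11ffff68301019081, 0xccf2dd12a3fa0b19f405d00f2c2,
   0x214a4759ce85c6399e4d2005502, 0x158fcf0e046ba0530052c3, 0xa5f8b0e3c88bb44000f083,
   0xc24d7c2b3b0d95120052c4, 0x1d2121585cdaea009700f085, 0x307faee8c192eb0160052c5,
   0xb6d8ea32b3eab80570052c6, 0x69495a6a627e7255541852c7, 0x73be3dcdb84268fda05228f089,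
   0x1ace6548f7a5a7000024508f],
  [0x136e6dd2ad3332ebf2205b0102c1, 0x20b999ed251ced7a5a002006501, 0xc4424613b0ff334a010082,
   0x14e95166a7c4b0140062c2, 0xc3e2235f3a1662450062c3, 0x19cf37418e0255334a010084,
   0x7ff5f568004006084, 0x117fc29c128ff760c20062c5, 0x31333ba2e09dfd42030062c6,
   0x1250489ac45e3dc94d20862c7, 0x73be3dcdb8426905605b4d0088, 0x5f4c331031da6900048608e],
  [0x158fcf0edcdd00500072c1, 0xc284beefcfffd2c0011081, 0x64929b2248007082, 0x24502c0c081007083,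
   0x264a2e57a04e007084, 0xf3e184cd204f007085, 0x56264e5f5a050007086, 0x1d8371e22a2051247087],
  [0x159463cc04c008081, 0x25a87aac248008082, 0x2ce48480c04e008083, 0x111f210eb73ce008084,
   0x6b9370e892050008085, 0x22fb651405cdd864b5fa4ba5a38c7a4a692506, 0xe8835c80cd894bba0064c82c6,
   0x1a5ba40ee580c0008086, 0x24b7743763328bbd82406882c7, 0x1046d5df15cb66e3cc02406d2088,
   0x85f713339e2f7a0000c808c],
  [0x81b15824081009081, 0xe7db1f0c04d009082, 0x11f95e6aaa04e009083, 0x6ad67ac5d6248009084,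
   0x231e23f3152051009085, 0xb1316eea92a052009086, 0x287e958f62ea418aa205c2492c7,
   0x8147fc4c5ac605a14e280013087, 0x9569708814bb2053289089],
  [0x2df25540c04e00a081, 0xe5bb98ec404d00a082, 0x60a8b9826405000a083, 0x1c57803448c05100a084,
   0xf05fd63cfb820600a085, 0xda8b1d46cf6e62d4dc05c014086, 0x14f20071d52a055c3a00e00a2c6,
   0x122498de2b6d576cedf44e18a2c7, 0xba84a6cf297e544020a088],
  [0xaf39a205938a001301, 0x408eccda46144001302, 0x1a5e97e5e0c18500b0c2, 0xf82395a5da050001303,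
   0x102e83e92ec8db910255000b304, 0x10a5227848ae6feb1c76000150c4, 0x131d9b75a9867847f3a49100b305,
   0xcbcb4529a2d0c9b99011001545, 0xd15d289be45b010001306, 0x7ff4e2306245a30b00b0c6,
   0x22fa0cd1ce5ef619638b0c7, 0x4837e9f77b14e009041308, 0x5ee08481c20002810d2],
  [0x5047bd65da04c002301, 0x286f0d8573c05000c0c1, 0x2650d2b5624248002302,
   0x36e332225b61f066a620700c303, 0x6d9a919323ff62f0cc2400160c3, 0x14c0fd77322074b50862ca00c304,
   0x1631846d7f23c5786600e002544, 0xdd5778771072054002305, 0x920eaa0520d1d2c000c0c5,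
   0x6f39fad60099c247002306, 0x4838085bfa7d6052282307, 0x492277bb4eb0a34c014c0c7,
   0x65bfd83195fd700005c20d1],
  [0x18c8989294b40c003301, 0x3286226072c73122e005c00d302, 0xf9ad0503270cfeaf8b4c00170c2,
   0xcf49eb3ee7e3eaa2f759100d303, 0x214a44f0cb91aa6fbc001003543, 0x12dc56fb1dac644f003304,
   0xcab932c38b6884c000d0c4, 0x81503411f6ada053003305, 0x144b07f8165975a05600d0c6,
   0x1ee285246ba3f6008003306, 0x4eb290eb00728f605840d0c7, 0x1e84fd4280bbb900f1c3307,
   0x1500a9060cf17730005830d0],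
  [0x20bf89ac389d1be70c05600e301, 0x101e54778e00b4affff2c00180c1, 0x14cc312ed6a390c85b22ca00e302,
   0x165521f77432ce63e6005004542, 0xcfd41b7744a0605400e0c3, 0x14e939bc009d0001004303,
   0xfdf80abab1be055004304, 0x1d21942e7b8a3d34d200e0c5, 0x38e1e43399086a011004305,
   0x1193785e806b4b2053004306, 0x790e1bbe15da7d6052284307, 0x2c109f89bca04d2b80c050e0c9,
   0x1e115aaa1ba520002440cf],
  [0xd622450e17ccade6c551300f301, 0x239a17f3a9af814b59013005541, 0xcfc1ca008d3b02c900f0c2,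
   0x14b284312b6d2008005302, 0x9847d8848b842054005303, 0x1cac1d34182f60605700f0c4,
   0x75cc0e4700d0050c4, 0x1027c441f5a6c7c057005305, 0x37c18e1749a87be058005306,
   0xb111c6109b50939605a48f0c7, 0x1f78e59d900a0850c7],
  [0xbcb12b76dffb04d20100c1, 0x14450dafa6be2001006301, 0xd7e531204c0060c2,
   0x1d39789f0578e355120100c3, 0x23fc65f60080060c3, 0x1a9039b0d265af4141006304,
   0x68eae62f2334ad8490006305, 0x1f7992bd520810060c6, 0xbf37391edd86201605a486307,
   0x856c1d614614fdaea4c02500c7, 0xb6a73dd937b460003060cd],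
  [0xc1a7117ae1f64181007301, 0x3c2ab28404d0070c2, 0x2fea839da04d0070c3, 0x5191228a338d0070c4,
   0x2081d3baec1c60070c5, 0xc31911c9e330a0070c6, 0x431363cc5e00b8dcc056387307,
   0x17168c039536c2c6494006910c8, 0x1509b87f1b10f900004870cc],
  [0x1d39b04c2ad5b0c0560120c1, 0x67c893340030080c1, 0x2dcaa4acc2070080c2, 0x11e3c38e8004e0080c3,
   0x1f6a4dbbb00500080c4, 0x2840fc5c7680510080c5, 0x36464e8a1efc648fa1a6adb91d248546,
   0x2bf1981d50a54a5612c0548306, 0x105f9b85b3689ffa27805c5120c7, 0x36cd062b1522460003080cb],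
  [0x3088dc9200c20090c1, 0x56b5d24f738a0090c2, 0x66c6af75a80c20090c3, 0x280f81bf3f42890090c4,
   0x4924f3931502480090c5, 0x1f2a4dea9187390dc1871eda0cd789546, 0x137932cd3ff8efc736a0c00130c6,
   0x7525c5e0c87cc423a8d40a0930c7, 0x130376c04925d7631b10006c9307, 0xd1ac91e62438400005c90ca],
  [0x11f9780da004f00a0c1, 0x5632f54ff00cf00a0c2, 0x1e8a8dfa1d205100a0c3, 0xf05d5adaf4540f00a0c4,
   0x14cdefdd8339000a9486080140c5, 0xed837165c03d9c20e01200a305, 0xd29d75c55a66e885912ca00a306,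
   0x956970881874a05430a0c7],
  [0x2871a9f3a5c08100b101, 0x1a4da511479ebe66401001581, 0x18c8980d4e6205001342,
   0x36eb02c6a61e4412ec65400b343, 0x1052baa7468d2050bff680015103, 0xda52736c14e815741405a00b344,
   0x1e1fcc81fe10280c6600b001584, 0xc0956bad4466050001345, 0x7d3e0b0c4ebbf30000b105,
   0x53157a8534a6a053001346, 0x1ee1c79f2fd9be052281347, 0x142d0f9aa4182a824058b107,
   0x5d85fa19e1b550000341111],
  [0xf823cea3be04d002341, 0x344037e83ccf3f326b51300c342, 0xf9ad04cd1ad1ea9e0c05d016102,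
   0x14bf6501942c13a66fa55400c343, 0x214a44fe0d2f13ae41018002583, 0x12d8130f09fa6050002344,
   0x60e8a0a1f121954000c104, 0x981f5cf03f012054002345, 0x863809400ee34c1c600c106,
   0x23e789c28a198e008002346, 0x790e71d3ec079b205830c107, 0xdfd4acb8e32c3900f1c2347,
   0x421aa1c6abf5c0000542110],
  [0x287fc71c892c0d434205c00d341, 0x10a522786596ded39c34c0017101, 0xca8a370e49233718f205d00d342,
   0x243413d46b435ae3e6011003582, 0x14cde2dcba6ba053003343, 0x8a069da9389632c000d103,
   0x8100f1bef5cd638c003344, 0x18f2dd4f6194a0f51100d105, 0x532145e8437fc002003345,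
   0x1a4ce04e4e6354c056003346, 0x68c604e38b4426554e183347, 0x73be3dcdba05d1a7605b30d109,
   0x127941d4014e000054310f],
  [0xcf4abe53b766d506195d600e341, 0x340a9f2ec558141926212004581, 0xa374857391acc05500e102,
   0xddd48a77fe06008004342, 0xba46a620e9b0c055004343, 0x1d39506b6dbc50f2ca00e104,
   0x77d680ec004004104, 0x156de7ba64c6a44053004345, 0x5fb62993362d5fc593004346,
   0xefd1cf1ffbb7a24f69924e107, 0x177d6add18008404107],
  [0x14c89014717d0051005341, 0x9bd165860b80a1c000f101, 0xc21c462a0b3e6389005342,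
   0x1ced8e956d05c2411700f103, 0x50af5bca004005103, 0xe070f8021c6005104, 0x518fab5c0103005105,
   0x5626a0f45a050005106, 0x1d8372be622051245107],
  [0x7cd351458485b44b006341, 0x25a87692247006102, 0x3021d0be8103006103, 0x10c3557c773ce006104,
   0x6707afe7a2050006105, 0x57242dcc9ed055c75fd1be4888610346, 0x171e8f7b9d01f5504008686346,
   0x9061ccd8b3b975a235000d0106, 0x4c66b45b6e205b0001c610c],
  [0x8022b6d4081007101, 0x2dcaa10b2206007102, 0x11f977fd9a04f007103, 0x4f049bdbc0050007104,
   0x230b0e70752051007105, 0x5c20eb6231ff542ca307007346, 0x125dd38abb80be4dfa34910d1107,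
   0x6f3d4c37551266629011247347, 0x67ec4f4ca223fe0001c710b],
  [0x3028b2200101008101, 0x101b731d0c04e008102, 0x5e3cd3566c04f008103, 0x2bfc3f2d92051008104,
   0x6235fa97564a3d5d63cd008345, 0x8ad76f5d7688a4d335ca012106, 0x1026b7e7526168d3db00c008346,
   0x192b4f5f9c04283dcc198408347, 0x3a52659f8d576054308108],
  [0x12136aabec101009101, 0x6c73bf4c223ce009102, 0xb7ad736e5c081009103, 0xe05a9228fa2052009104,
   0x11d9d3d0407b480ef54081013105, 0x3461992ff4d4edb612058009345, 0x11b6cc189ff68780fda05b009346,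
   0x956970881870c0532c9107],
  [0x48cbdd868340f00a101, 0x1a6108b948c05100a102, 0xf05fd63d15020600a103,
   0x1025b62ef6ef0acebdc05d014104, 0xfeeb9de031e4aa39e00800a344, 0xd83172e0b0c9f8a50c05d00a345,
   0xbca8f1a0f3d2b3ce00a106, 0x35cd7ef081800211430a107],
  [0x18c8988e65b40b001381, 0x34141a52ae924abc1f3db00b382, 0x14cc312edb76156866c340015142,
   0xd94e27da434c92869959500b383, 0x13348674875019382501c0015c3, 0x11a7fb24b06c604f001384,
   0xcc756167fd3d60c000b144, 0x7c57ff32bcfd950f001385, 0x15b14de34b2b41e05700b146,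
   0x1d6c1dafbcd4ce008001386, 0x2b63df92d5618f605840b147, 0x113cc34bb5ce8d400a4c1387,
   0x5d86b938695e6f000201150],
  [0x31ef91d259236990b605800c381, 0xaf8c48d7e2a8bfff8a580016141, 0xcc037f25a886392f3e05d00c382,
   0x1631837d3abbd952be00d0025c2, 0x205d513c4b6604e002383, 0x8324af3ed754418000c143,
   0x7c2f180eef126243002384, 0x157a8880ba975ca05700c145, 0x2ea10f2fa58d49014002385,
   0x833117cd9b461f34a002386, 0x457c00ccc733e0e051242387, 0x2c10bfdc4357f03d80c04cc149,
   0xb447488fcae5000018214f],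
  [0x97bea8b61c34f7e3c205a00d381, 0x2940c66b2ec099993901c0035c1, 0xb5d5f1f1f0a8538d00d142,
   0x14c89014b5132008003382, 0x7117a0f394194101003383, 0x1c85946879c97ea05700d144,
   0x364cf76007003144, 0xefb91d67e4d41b491003385, 0x67d47e071a6b7b8058003386,
   0x1506297493311e2652ca08d147, 0x260a8d8c8f010203147],
  [0xcfc50787b5cc405500e141, 0x14c86fa4daff8005004381, 0xe0faac204c004142,
   0x1d1bc934e90f80405500e143, 0x1d1a226d00c004143, 0xdfd33102103004144,
   0x7ffc261a4bcdfe6050004385, 0x4715b25aa2050004146, 0x6f817e228c396229605a48e147,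
   0xbc2d122659011244147],
  [0xc24b9d44b161e182005381, 0x25a87654206005142, 0xdfd3ad0734c005143, 0xbb7d901c6185005144,
   0x665eb57a2050005145, 0x28574ebb680289005146, 0x5a01086df8ba974a9510085387,
   0x1046d5e1da95a7cca613c068f148, 0x8b98e78d5919f700054514c],
  [0x1d259f4124e3844057010141, 0x7fc903ac009006141, 0x1e5cb5c2a04e006142, 0x53eee5f7834c006143,
   0x208426d86b38b006144, 0x1601b138752051006145, 0x2a8373a8469f77a041c5006386,
   0x287e958f1000bfa47605c286387, 0x101c17ff1f620f944f12c05d0147, 0x18f70d77d337c3700034614b],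
  [0xc1fdc8f937d836056007381, 0xbfa1a98aa04c007142, 0x673467a2ba04e007143, 0xc4fadd69bb30a007144,
   0x8a2d62cb032c0314340f007385, 0x105f9b85b368d6a469205d251146, 0xbca77ff5f10835a27016007386,
   0x131dec53ffaad1599be012747387, 0x76c106d83932940002c714a],
  [0xa175c37a004f008141, 0x50743a803004f008142, 0x16ac839a2a8051008143,
   0x4bdfa2bcfd118a9302ca008384, 0x14bd1a6650d8492c023553012145, 0x33567c9313df56713300f008385,
   0x61a90035d1a59979ece05e292146, 0xc45820461aa5a22706014708386, 0x2f5ee2a0fc41de000408149],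
  [0x67640d6d6a144009141, 0x28f37d1f27c050009142, 0xf2aa1245f821c5009143,
   0x11604a1f096d7811f2c288013144, 0x22dd3b6ef5550cd8bc00d009384, 0x5f66834fa97242817f48f009385,
   0x3b90d0d47363c30a009146, 0x15dee7f8bba50e056289147],
  [0x26c131c1d1004f00a141, 0xf2aa154c25240c00a142, 0x1373ae37949b2e384434d1014143,
   0x2b26bf376e474d670601400a383, 0xceb0c23d1be628022131900a384, 0xcef9e1c199b6f55400a145,
   0x15d12a9db765d738d00a146, 0xa4d3d2e5b06971ea9b8f38b0ca387, 0x1c6ca967cee13224401ca147],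
  [0x3088a36e2b5604353424800b3c1, 0xd62201f3cf2d85d2cc6c0015181, 0xc8f906f6455a90fa3938c00b3c2,
   0x3aab2f39bf2466666003001602, 0xc22fe758ae6604e0013c3, 0xc226f1b9772282c000b183,
   0x7a948bbc50a3e0520013c4, 0x174b18b1d48628c05700b185, 0x1d704ec921f71c0010013c5,
   0x11769f207ed5a9638b0013c6, 0x3d711243a01eba60522813c7, 0x5ad690cf3429aa12569944b189,
   0x77e933e75386be0000c118f],
  [0x13855c041cc55b5cebe4d200c3c1, 0xed6a28c405f19999e212002601, 0x9b7c8e0004663030023c2,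
   0x885177554f2cc05500c182, 0x7c2f2a87797c14d20023c3, 0x861a0c18caa39b45000c184,
   0x332fc29a003002184, 0xbb0b5bbb977a120540023c5, 0x45fefed0f2d5fbe0570023c6,
   0x127302fff1eafaa94ca0823c7, 0x4f4e60c5fc7e8badb65828c188, 0x2af7aab3ae129400010218e],
  [0x14c890149a9f00510033c1, 0x9f749c8ca57ff50000d181, 0x640747a144003182, 0x5eb25de204d003183,
   0x1a488df6a04e003184, 0xd5112162204f003185, 0x28ea5c59e7655d1130a0033c6,
   0x1d87cd99e22051243187],
  [0x5323fab89d2b63c40043c1, 0x25856a1a0c2004182, 0x2382b6e9a04e004183, 0x105a81d8aa04e004184,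
   0x1f8ff1dd4c38d004185, 0x197be3116e0051004186, 0x39a4b36e7f85495fc0592c43c7,
   0xd4c998d185f61ab8cd3c018e188, 0x1e0d052f715e0c1403c418c],
  [0x1ced91f6480b68b59300f181, 0x4f144f78001005181, 0x2c529026a04e005182, 0x112e19f6aa04f005183,
   0x650f987a132ca005184, 0xb7834376a8081005185, 0x5c0229c753d91d3b64c30053c6,
   0x105fb73a82ccb58326005d3cf187, 0x39f074e9f432c5b8d00a0853c7, 0x77e1e1ae3397e400048518b],
  [0x2383c3dba04e006181, 0xb6245b4a804f006182, 0x46501cb74340e006183, 0x197ce222a98051006184,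
   0x816a894113c5696c63cc0063c5, 0xe436d651ea0af3b5c405d010186, 0x131708174e31ea50a10180063c6,
   0xcf041d0c01a25520025ce1863c7, 0xad865961fcca3340086188],
  [0x1120045e6404d007181, 0x62cce6d3c6050007182, 0x16302e9f14c090007183,
   0x50c2b3c3a968215d96170073c4, 0x144aa60c9293729532205d011185, 0x31b9f12983a290f6d90140073c5,
   0x11a4b36b064b643c39e05c0073c6, 0x734ccf3ebb6b08ba0a534c1073c7, 0x7d37fd09d36c62c0547187],
  [0x6bd82df8d804f008181, 0x28fb952df24248008182, 0x6cdf442baaafcd0f809a0083c3,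
   0x9ff2a0aece06fdb82405d012184, 0x14f06505f3ee27021000d0083c4, 0xc2bb585744ec347b3405d0083c5,
   0x6ef392fa3aaad450008186, 0x2f6a87aad406a3491148187],
  [0x2908b53d8b0091009181, 0xe04badf1be2052009182, 0x9893682e43f5f52b68481013183,
   0x344037b7968dfb19862c60093c3, 0xb541dd65f0fdaca4621840093c4, 0xbcfa50bee9146054009185,
   0x1d948b6150411a5619e779d2493c6, 0xe2b52564e02c381404c9187],
  [0xf05fe86475020100a181, 0x14ce68730dd7492d4fe2c8014182, 0x241075629275cafe1c00c00a3c2,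
   0x3686cc86eb479b039205700a3c3, 0x86617bb2d213a05300a184, 0x43bae90f34104b38d00a185,
   0x156a8955bf461b005500a186, 0x818bc712f8c7731aac5605e30a3c7, 0x668467077fca5ea4a05b40a18a],
  [0xc3a2187419c4a9780159400b401, 0x20b999e4ce5f666679015001641, 0x15439183b33e604d001402,
   0x7edd401de35fe48000b1c2, 0x7c2f16419e59b50e001403, 0x8355ce787d68ff30a00b1c4,
   0x5450cdf700b0011c4, 0xf989d9b29a361e101001405, 0x28acfab16f01106055001406,
   0xb111c603b29db4c405a48b1c7, 0x1f97e39b900a0811c7],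
  [0x17ab5b5281a6604c002401, 0x837f14c8c606450000c1c1, 0xcfce35204c0021c2,
   0x80a06b367d48f205700c1c3, 0x4d9dca9a0020021c3, 0x18db57b6a04e0021c4,
   0x6ad5e210494c24c056002405, 0x37cb1eb4ea0500021c6, 0x1a132f5ad30b415e053282407,
   0x84e045c86ef42a3f664034c1c7, 0x5e2c811ccb070a0003421cd],
  [0x533789a8644a6055003401, 0x545d0aa804d0031c2, 0xdfcfff6734b0031c3, 0x9d25d5e9a04f0031c4,
   0x1f8ff0d39b34c0031c5, 0x105c73f79ca0510031c6, 0x39f3abcf201c127d6052283407,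
   0x36258cb11fa0e953dd48010d1c8, 0x616c5318bfe5930001031cc],
  [0x137b8e32c0483901c600e1c1, 0x4ec874520040041c1, 0xe07174a41850041c2, 0xd5104ace604e0041c3,
   0x1fc42965a42060041c4, 0xbdba375eab3cd0041c5, 0x5a00c9dad2a42ff1a2c5004406,
   0x287ec8085a736ba476052284407, 0x1046d5c1fa0cba3963a3c074e1c7, 0x11f927e368bf3640005041cb],
  [0x11c771f54e0af80055005401, 0x1095592f6c04e0051c2, 0x1fcaf952a52ca0051c3,
   0x265d0db4e622890051c4, 0x5a043dffcf508d4a9510005405, 0x10a194407edce50ad4605d00f1c6,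
   0x2f85fe37435b32e54e010005406, 0xc39bba4141f1ce9b61595085407, 0x4e22d62bf728c0c03c51c8],
  [0x1106761de004f0061c1, 0x48b508686a04c0061c2, 0x1c712c1d7a20500061c3,
   0x5768f8d0d7ce96c02056006404, 0x5b8aebb88674aa457205d0101c5, 0x20dd369dac024958bb00e006405,
   0x12ea94becb3d149989e2c6006406, 0x956974e4081a60543061c7],
  [0x67624900301420071c1, 0x286289a18623090071c2, 0x2af85af7bfa02583248e007403,
   0xd1fd5d8c263ebd317a05d0111c4, 0x1995c8af9f5551eb8000d007404, 0xb36b673d804ddf05cc05b007405,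
   0xbcb00a605a3cc2060071c6, 0x27b9f9ae59ab652ca0871c7],
  [0x268783e505c0c20081c1, 0x8b552d525a5bf87d605b008402, 0x131d9df4ae3ea985d824d20121c3,
   0x31d668d140e81a0438012008403, 0xf9acd592866ba0e04805a008404, 0xa63ff53db56120540081c5,
   0x1b64a7edf64ddde4073734c108406, 0x82ff11198e056c1c05481c7],
  [0xf2aa143b5e21c40091c1, 0x1388e987bade144d2a605d0131c2, 0x2416651ab5e90234db016009402,
   0xcf49c574b73beded18591009403, 0x3a5a2d381f7b01010091c4, 0x4dbcc9a6d0001b5540091c5,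
   0x8619328474264c38d0091c6, 0x68e69ec0925f2f95d62091c7],
  [0x133682fc545d4bdaf3a7090141c1, 0x1b33d38ccc7bab79cc00b00a401, 0xc7ca8118076ff267c934a00a402,
   0xb794f620648d414400a1c3, 0x2f4e32a5f02a3730a00a1c4, 0x1b84adce797a08034a00a1c5,
   0xaefc0344648b9fc05800a1c6, 0x26ef6a59510634a115f9cd40f1ca407, 0x37a1ab7b0f8f074f605b34a1c9],
  [0x14c86a3ce465a053001441, 0xc25786687144c18300b201, 0x7ca369766566604f001442,
   0x127d88fdd61422d38d00b203, 0x1e3170de003001203, 0xbaee9e3033bdda053001444,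
   0x4619fed941efef6056001445, 0x1189191168a1b93a056001446, 0xece1942d79c52325655201447,
   0x4feae273d6da81cc740f0cb207, 0x5e5de09327d6ce00014120d],
  [0x7cb215a1c89e8052002441, 0x257b6d4e143002202, 0x1c78619e738d002203, 0x9d232306a04e002204,
   0x260a8ea5c204f002205, 0x25e49e21e24248002206, 0x39f074e9f42bc95fc0532c2447,
   0x146683ff2ac485b97df34010c208, 0x769515f7cb612700008220c],
  [0x1d22b9cb544d09e05700d201, 0x4e52a23a004003201, 0x1d3196f02143003202, 0x542adcd1930a003203,
   0x46d1db536604f003204, 0x26671a6f8d8051003205, 0x3aa0a0ad05f8ce26005a003446,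
   0xcdecaf4b16ed9217e1d1643447, 0xb3e3d8f569fd3115a825370d207, 0xfbdaa5936f35d800048320b],
  [0x1d630bc6738d004201, 0xbd92fc7860c1004202, 0x3c8aa3f078050004203, 0x265d0db4e24248004204,
   0x60340029cc255256539b004445, 0x13092904e8ca21c4e405d00e206, 0x1b33c1f53e25f490ca001004446,
   0x5fb48c27b8b062dae40562c4447, 0x525a4afffec5e053244208],
  [0x112ea269e604e005201, 0x46501ca8121c5005202, 0x18c8878ea1a38c005203,
   0x5a263c492d3def87c30a005444, 0x12eb55a9e46e114818059500f205, 0x8895da9b2f3ef28e6001005445,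
   0x4c13836a50f6b99bf9d5d608f206, 0x205d95ad5d2600f005206, 0x15d52d826e60f700a085208],
  [0x664d806e28081006201, 0x18cbbc960340c2006202, 0x60340029d143f0d2e05b006443,
   0x1341a3f09880cbe4a4f34c010204, 0x20774d5c8bcf96725801a006444, 0x11af69e81ce34f89edb656006445,
   0x4214d4e12e206055006206, 0x2f68d7318eaaa348d146207],
  [0x266c4df3742050007201, 0x5768f8d529a3c827e442007442, 0x13864ba91ec6e1ce5b005d011203,
   0x15c4a115795c609e1e005007443, 0x83fde31b3679793fa605b007444, 0x6f365836ca650490007205,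
   0x2a187d8c841a161c6007206, 0x462d851ae2e1cf576036a79d191207, 0x93c4189deccc8e00c5c7207],
  [0x8a2d8eddb257e156e052008441, 0x12ed8d00efa7c83d18a2c9012202, 0x214a880f7f5dc66165490008442,
   0xc7d1592d1150c59ad5656008443, 0xc3999c0cfeed33cc008204, 0x5fd8800fb9afc055008205,
   0xefaa07d61301124d2008206, 0x417fbccec5f61ee5a2ee134a088447, 0x6ef7dd1fcaa5d0a1624060820a],
  [0x14ce5b2f13ecff83628081013201, 0x1ae3cafcafd69e85fa009009441, 0xcf4abe2173eecc24314dd009442,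
   0xbcf4a0b58af42055009203, 0x4288d684f817814d0009204, 0x1225fe16ebff72838c009205,
   0x26a662d614aa2a2057009206, 0xbc8fb0551a708a01627dea062253207, 0x318c2990b81f966500b089207],
  [0x888d50ed3d657c486405900a441, 0x87243673709fa04f00a202, 0x4d171d9431680d49100a203,
   0x1b85c53830524c450700a204, 0x95fff714e070ef205800a205, 0x389edc73d6fd0c175d500a206,
   0x1b5d17b862621b5e05828a207],
  [0xd0131392ca001241, 0x4ded5346103001242, 0xf9d3c5675dd61e101001483, 0x9d26022ca04f001244,
   0x219c15708a35b6a958f001485, 0x1618707b4da051001246, 0x5a010887bfcf2faa950a081487,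
   0x7daae6230c966d610c34058b248, 0x61ea8505540e2b00020124c],
  [0x4eee10e52ca002241, 0xe07171e6185002242, 0xac2777d673cd002243, 0x1f9fb1178c183002244,
   0x1aa82823e5b450002245, 0x3cade0c6fd855a7d605b002486, 0x22e6b67aae357dd476502282487,
   0xe3bc8c70faac5a48a92c06cc247, 0x68b6432de5957e00048224b],
  [0x118db5e629887a4055003481, 0xb03cecee6183003242, 0x292cef331a050003243,
   0x161870abf42051003244, 0x5a010887c018e6222081003485, 0x11d5c12c8aedc1809f228900d246,
   0x1c586e1ce59e40054e4c9003486, 0x9b4135f40fd6052283247],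
  [0x112e6616be04f004241, 0x441d774df808f004242, 0xe6e06d9f42051004243,
   0x5768f8a0f2c6a611a3c1004484, 0x10a522736732ba5204a05d00e245, 0x1bfa965653f7dc490d00c004485,
   0x12dc56fb19d6c054004246, 0x4e8e01d1cd372934176604384487, 0xc0956c988a3a2c0504247],
  [0x47c728fac12ca005241, 0x18942d9045a050005242, 0x5a04480ca83a25a11512005483,
   0x14cb6fc39e9ab0d7d2a30b00f244, 0x24107686622305f58605b005484, 0x158fcf0e03846054005245,
   0xb2850db803005490005246, 0x1653d919c13b5f44f0c5247],
  [0x1af803d2be33cd006241, 0x5953f3ac2156a856e055006482, 0x10601403126ec24b72c05d010243,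
   0x22e7b58637100b554b016006483, 0x83ed7dbf223de80a765c4006484, 0xbcec0496d7922055006245,
   0xab76d32826e66cd70cef6990d0246, 0x483808d4f36a500a086246],
  [0x5a044be5eb655480a081007481, 0xceba324d302886e94871a011242, 0x218328182a7ef2649e001007482,
   0x158c7b933b150050007243, 0x53157b17a0afa054007244, 0x2ec4f92c7ff22a054007245,
   0xab04c2bd1daa7ebe7a1d6d8107486, 0x130235a43a06add500247246],
  [0x11e197efa8cea31e95c05d012241, 0x239a17f5811a26013e006008481, 0x137394e7a87c874d734501008482,
   0x717104b17660a246008243, 0x33bcc53dc32f9a081008244, 0x131d3cda20f41492ca008245,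
   0x314a3502b1aa55f38d008246, 0x1184ded39910acb2058008247,
   0x48cb723f9953aab5a87b2aaeb16406a6086c8, 0x8679d66de9d4c684b4cf1c8249],
  [0x158f9e6b0a75004e009241, 0x5e17916c94672055009242, 0x23a0936a0e7fc4056009243,
   0x1a4ff120477b722057009244, 0x6d072e8a9297f16058009245, 0x95ece53e67bfa9796de3838a1253246,
   0x31709bcee0f1a39d011249246],
  [0xb2a1e1635db021c500a241, 0x32ae73f756032205400a242, 0x1b4bf8727b02efa24200a243,
   0x676f9e280271dc405600a244, 0x3dea69ef309963dd34c00a245, 0x1621651059975c89805a00a246,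
   0x1dcda2bea3a5de0205b4ca247]]

theorem valid_table9 : (table9.all fun t => t.all (valid 9)) = true := by decide +kernel

theorem complete_table9 : complete 9 17 table9 = true := by decide +kernel

/-! ### Support {1, 10, 11} -/

/-- Encoded growable realizations of multisets with elements in `{1, 10, 11}`, grouped by
multiplicities as described at `complete`. -/
def table10 : List (List ℕ) := [
  [0x122c1f184c10100c041, 0x66c87e572c2ca00c042, 0x280f978c6a805000c043, 0x18059260fac1440012c4,
   0xd2bbe4a670b30000c044, 0x517301a0409205300c045, 0x37c32e5fbb4e2470012c6,
   0x1efee75231f9c1c000c046, 0x23193aa25f96fa29403405f00c2c7, 0x5381ae94c5e262ff7dfe3c1017047,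
   0x1e6ca359db98947dd4760542c1548, 0x1b648a88ddc25b33e8ea08044c2c8, 0x8339702eb52a0f30008c049,
   0xee521da2be9b200000412ca, 0x5d85d9437789330000c1054],
  [0x93b4749aa630cb98f554018041, 0x268612bd7fa34c00d042, 0x1dc35bd30d604f0022c3,
   0xf64fc56f10d34000d043, 0x5a24bf7fb20d3ce00d044, 0x3bfb72a33e5b4d20022c5,
   0x1bb2b0007172330000d045, 0x1d3555bd207df68f3f9c05f00d2c6, 0x2dafed47cc943bd4ebd7580018046,
   0x1e6dadbd5a1ab92a1af2058002547, 0x4ce555065a965d19cb0238074d2c7,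
   0x4a38ed296cdd5a4fa46605d2c2548, 0x3a31bfd1eb345608000d048, 0x957dfb50e084a713005cd049,
   0xeef0582a02413e0004c22c9, 0x5d85d9813772000002c2053],
  [0x268a88820cc0c200e041, 0x18c891661820c20032c2, 0xb1827bc84cc05100e042,
   0x5c530cb351ac0c200e043, 0x37435e9d8cda0530032c4, 0x1e9813b615d8f48000e044,
   0x1d36a244abbe9ac360bf75900e2c5, 0x118e2a4675dfbb78027e35d5019045,
   0x1e6ca35b9c9e1f1de43405d003546, 0x80bc185bf493f2b0ff7814000e2c6, 0x13da1031a5bb25605700e047,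
   0x117656312fc17463495c32c8, 0xaec9686b068c38a34000e048, 0x127413c6920164073c008e049,
   0x5d861e89c350f5000143052],
  [0x18c8916770134b0042c1, 0x10a519b3d963e0e0f4c10001a041, 0x49deb29b95ac05200f042,
   0x3c900b9786913cd0042c3, 0x18eb1c4708f4c34000f043, 0x2a7eebb938298f7a4fef4d200f2c4,
   0xdd1131cd8243c3d2fd7206001a044, 0x1c16aa2ccc01bafbb9e77d1004545,
   0x4d196ccbb10197e4e9a205e00f2c5, 0x1270b43e2d889da05700f046, 0xa4623f8e9eb0460570042c7,
   0x349aae2a6d6ff460c000f047, 0x5995cb65e5b528c1424042c8, 0x79c12d48ff2c66010000f048,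
   0x15c602bd9c6a854381c558f049, 0xac6c6ae3a45000304051],
  [0x5d0ef6229da0520052c1, 0x63dece76043fa8ccccc05301b041, 0x399816b757da0510052c2,
   0x22a337de8bb0534b010042, 0x1b82d9ffd40d318d00bf75c0102c3, 0x118e2a5ae2ff0a3d2fd7206001b043,
   0x1c466b57c6e4714f665e554005544, 0xb6714fac3d75adda9b7834c0102c4, 0x1d1b32abc60a236056010045,
   0x19c2ceb44661bf20560052c6, 0x7e13525a27e93974c0010046, 0x126775bba85252bb5d6010047,
   0x2abc6b403f4225e60542c52c8, 0x6dd732034e6de04b4d2010048, 0x9051ad32098238283580150049,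
   0x185adb5d0cf4b3b0002c5050],
  [0x3cae75a44c1b3ce0062c1, 0x19c94013f68ff3c0011041, 0x2eae65b3f729b32c80d344d0112c2,
   0xd28306ee18f2d2ffffff30001c042, 0x2c32706a05cd2db8a92405b006543,
   0xb0b0cdc962774937c3ff3000112c3, 0x1ccae86575b1434057011044, 0x156a1a6c7f7335e0540062c5,
   0x9fc1f68cb50d11c144011045, 0x12811ea772cee6761c6011046, 0x765bfa842a20acbf658011047,
   0xc98b6cf0ca6d21461c54862c8, 0x91142bcb73f97b8a0180011048, 0x2f4ce35327ff2d44f13005d1049,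
   0x40a8bbf82b0a0002c604f],
  [0x1da4e85c695c266869cc5460122c1, 0x540c82b9472234cccccc55401d041,
   0x1c16e2ccd684884c768e553007542, 0x114a8b7ef22fcd9b2957805f0122c2, 0x12712b6cd7134cc0c2012043,
   0xd0d09e75fffbd40570072c4, 0xaf555a6b5b0db14240012044, 0x407ac7fb4c326dda04f012045,
   0x407673c9dd00078a059012046, 0x145950f1e6d088d0fd45b6284ce7522c7,
   0x93f41e0b826941a24140012047, 0x42633aa058121a47800b5072c8, 0x2b68d925bdeca65f36280012048,
   0x366446230222fe66b8180592049, 0x3fc42e19b28000048704e],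
  [0x2c318fbeb1ad2d485a66058008541, 0xce6f38cc265d9ef7df180c00132c1, 0x1d39cdd38b30fb03ca013042,
   0x1b49589e88ed6aa1440082c3, 0x9ad45e11c3875f21d8013043, 0x41c1cc9fe2545e26059013044,
   0x1894550a117295a6f554013045, 0x935cb7b5a3f7064c42c9013046, 0x4b9d0055e711ce6bc2450082c7,
   0x73c2f483e61e0ec60280013047, 0x11cac3714c99bd5089c2ca013048, 0x6e1443046a4e73aba7009d513049,
   0x516247fd224600a048049],
  [0x12712bfac00cccc0c2014041, 0x11a4dbc4ffe08d00550092c2, 0x6cb8fb4c0c0009042,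
   0x349b427af8a0a64c059014043, 0x56b582e8a04f009044, 0x939720070acf7395a554014045,
   0xb85f6baf12051009046, 0x10a333f4f5fd2edba8c05c014047, 0xd75a5780f102055ba60592c92c8,
   0x4d64875f1fd40c0009048, 0x18e6e816adb0e2c0049049],
  [0x18f5864e5cbc75610100a2c1, 0xaf5af6a6a5ec96c54a015041, 0xe943574c04e00a042,
   0x11e3d85f8a04f00a043, 0x20840ed1dc05000a044, 0x247e38969f521600405b00a2c5,
   0x201d5bf988b30000a045, 0x4929212595405200a046, 0x1b826e8ba11014400a047,
   0x4d81dfe5ca19f9180582c758a2c8, 0x1e84dafeed18030000a048, 0x536dc3ee4486164fda83480215049,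
   0x18fab691f5525190002ca04b],
  [0x3092810440c200b041, 0xe8af7357404e00b042, 0x93a6d115a2edc93bf6cb016043,
   0xc50d5e4b6234c00b044, 0xf5e0592fb4a05200b045, 0x427b24869b4a05300b046,
   0x1dcee48dc7a4c05400b047, 0x2e197210ed21803597b205f28b2c8, 0xcb12b9f2282403f05353300016048,
   0x85f7148966c15c34b5cb04a],
  [0x6d78e2342808100c081, 0x26c4def3be740f00c082, 0x189d479522940f001303, 0x726a3c3784e2c000c083,
   0x1b82c92e6dbf30b00c084, 0x22e50109b4da053001305, 0x17e9e72b6ad674c000c085,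
   0x18a0b12b28ffdf0f7c6a05f00c306, 0xc9f25957b2fa13192ccc440017086,
   0x198d4c998e910e2c4dca304001587, 0x4f005925eb2c5f6c5dd859500c307, 0x18ea548d7a9e00c2895cc088,
   0x1e154ce016847c001301309, 0x1e0509abbae3800002c1093],
  [0x28411a5360c08100d081, 0xbdbe2691a6203002302, 0xf5e5adc76762c900d082,
   0x56b8e61f5fb005300d083, 0x37432f5e53be052002304, 0x228d73ff2afe150000d084,
   0x1d1c951370297c70ec5205f00d305, 0x1121f8f7d1d76c091e4cc200018085,
   0x128cd31585413bd3532c541002586, 0x80bc60e2d0765acc876848000d306, 0x19b021e02aac3ba05700d087,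
   0x85ff5aa89693463895c2308, 0xacb16ce72f35c3820054d088, 0x4ca1a5f20b000582092],
  [0x10d6da22f36051003301, 0xf6268d7947214000e081, 0x5affb7ec55a738d00e082,
   0x1aaf250a5d5d48c003303, 0x229fb3babb2c224500e083, 0x30fa6a70d5dc3e6b15805e00e304,
   0x104143a98f50905f87c92200019084, 0x30d7e5ab67441341a3a05f003585,
   0x5da0e0e66c7ab1ceca2954000e305, 0x19b53bbbeddfbb628800e086, 0xa3f26a5463b872056003307,
   0x92d2da80a87a23420000e087, 0x380f3e3e5fbcc90c3075ce088, 0x9a89ca272c5a242c0096c330b,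
   0xcc59b97e10002c3091],
  [0x5c5489f81f0c08100f081, 0x39784702e190052004302, 0xa56241e0b7bf38b00f082,
   0x2aa6a29f769b7b463aa028700f303, 0x1121f8f7d1fb56015a4cc20001a083,
   0x1c16aa2b2c0794ef97fe05f004584, 0xdf967d38f516edacc4c538000f304, 0x19d0f2131663d6c08100f085,
   0x11ea59b895b49b2057004306, 0x349b45d82a7156240f00f086, 0x3a1006ffbfef015549000f087,
   0x26ca244ea4df982e058284308, 0x15ba14e87865a4da428068f088, 0x1d81bbd386eb80002c4090],
  [0x3c10285591d140d005301, 0x22a35934f8cb2101010081, 0x2569c863d41938bb1aec05f010302,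
   0x118e2a4672bf354947fff30b01b082, 0x284a631ac3ac3c5f5ac6302005583,
   0x60a567113548762b5a783c1010303, 0x1d39cdd38b2f46c289010084, 0xefcc2a6b302a3a055005305,
   0xaec9685df7bb997580010085, 0x20a97431a85ba674059010086, 0x18a700ea5c5108196616010087,
   0x7e224c934e61d090c1855d0088, 0x8a42f383b41e2a2c0095c5309, 0x1ad03568da327000018508f],
  [0x2e564a9ac5a7851fa77a79b011301, 0xe0b5515950691f524c436c001c081,
   0x1c16aa2d02109fed41b805c006582, 0xb865586288c21f043d70140011302, 0x19921605fb44b4c081011083,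
   0x1a5fc4008ffaa82056006304, 0x9fc40c3bc5e9d74057011084, 0x3a15e708845ffa64183011085,
   0x18944552eba5994ac289011086, 0x6ad92c37210a5d53205b011087, 0x51dcaa6898cc83a5c38d006308,
   0x3666bd3918491784b80c0551088, 0x243bc0bb106fc4d4a4491706309, 0x1f257d3c9b0000044608e],
  [0x1c16e2cb4379db73143a05b007581, 0xd9f55d5575ca0c5a5e83300012301, 0x492a3a1983fffa057012082,
   0x122ed6d1d16a964057007303, 0x6d6f2fb609c4874102012083, 0x349244c388e38c66059012084,
   0x1896a928c197c2b44491012085, 0x9359b13bb1bad9fa030b012086, 0x2f71fb5c725665d3405b007307,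
   0x2e419880fa9cf8196f680012087, 0x11bd32da09d2bad090c2035d2088, 0x4ebe5a6bbcd7013287089],
  [0x1b819a69006cccc1c1013081, 0x76349e3204d008082, 0xd9ea4a64103008083, 0x54bb12cf0289008084,
   0x1e9b2ab90c081008085, 0xbcd970d470289008086, 0x11cafb8f9b81165521f617013087,
   0x516247fd22a2053288088],
  [0x81b526ac04d009081, 0xe20e01cc289009082, 0x1202ac280c081009083, 0x6d3248580730b009084,
   0x2859d992912051009085, 0x4695b147dd2052009086, 0x5538956e7a4c081009087,
   0x2bee2a344b2ec98d4f2019f594088, 0x2acf101497ff6bf31af4014789309, 0xb436592a2079e00044908b],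
  [0x300ddf4dc04e00a081, 0x54e00fbcc28900a082, 0x6ad43b082405000a083, 0x283d4c6b12140f00a084,
   0xdcd8cf1894a05200a085, 0x42a91698ce2805300a086, 0xa561ec845c3828700a087,
   0x21ad8e8f79df07fcff2a05f00a308, 0x50c30187b10c2f639a4c6c0015088,
   0x42664318836f50f3aba8384b5d5089, 0x11f9c25e8cf375e0111ca08a],
  [0x1213662b4404e00b081, 0x8303e8acc05000b082, 0x268b05fa5d405100b083, 0x49dd5b7af3b38d00b084,
   0x3a74673fab4a05300b085, 0x9ec60782000c10300b086, 0xdeac24caeca710aaaee30a00b307,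
   0xcaa61b4e8757a352b87b580016087, 0x67c4590eaed1f7a0e3628381656088, 0x190c49f4cf75aa300d10b089],
  [0x2819aedda2c14300c0c1, 0x18b03d0a676051001342, 0x9bfc1e52d8434000c0c2,
   0x5a23fd10cebc1c600c0c3, 0x37c35738534e245001344, 0x1d946fabacf674c000c0c4,
   0x1c46a9d5251fcfc2ea002ca00c345, 0xe0b518b9184931ee40d34000170c5,
   0x198d7909b4477861a2a95cc0015c6, 0x98944304ee0a3e6ec9173c000c346, 0x1d39cdd2349198605600c0c7,
   0x117651de49c0f4634c5c1348, 0x8b842ad2d325b2244018c0c8, 0x5d888eca837d330004010d2],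
  [0x18a1ad5114b44c002341, 0xf650992383a14000d0c1, 0x3b54d5aba72420600d0c2,
   0x3bfb7a6ca59b4d0002343, 0x19bb2a4f5258f48000d0c3, 0x2eb2d84153e9b2ca782744c00d344,
   0x118c497f89496a906beca34c0180c4, 0x27c9f36e61c517675fba2c40025c5,
   0xf783323d735525e14e9a1c000d345, 0x144adce2a36387405600d0c6, 0xfbfd3864834a72056002347,
   0x8930fc49876721e05800d0c7, 0x5995cb65e69160c141402348, 0x39f037c03d90ecf00583cd0c8,
   0x15e50ad6b280000420d1],
  [0x5c5d13654f4c05300e0c1, 0x377147a7c5da052003342, 0x21f6eb71802973cb00e0c2,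
   0x2538f8f55725d092b69c05f00e343, 0x118e2a5a6963854fe39f20600190c3,
   0x1c16aa6e48338a2f2d665520035c4, 0x118dd0359cd4681a41f7824000e344, 0x1a88e91a91f2e1059300e0c5,
   0x113cd004504d25e054003346, 0x1d35c8fcd4d2dcb48000e0c6, 0x383a271c78c4cf6f65800e0c7,
   0x274a38360c85217e3c9643348, 0x15ba14e827506490234068e0c8, 0x18465ee99ea980003c30d0],
  [0x3c1057f3825b450004341, 0x19f65509b78cc3c000f0c1, 0x2eb2d97ec09d56e840194cc00f342,
   0xcbab4e58d6ede4cccccc58901a0c2, 0x27ad1b53ddd778b8939a2ca0045c3,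
   0xaec8dfdce75526436eb968000f343, 0x196beb842ff0a853ce00f0c4, 0xfbdf552b82f430052004345,
   0x9ae1f912187e05c34000f0c5, 0x3a0d6f51116830a61c600f0c6, 0x188f7282d674ff13c05a00f0c7,
   0x825c80b6e78ae5a7005a44f0c8, 0x87f12470e442b3dd70181c4349, 0x1e1ebe7f0644500002440cf],
  [0x254726db2de2718f034205f010341, 0x118e2a5afb51539b87f3a5d601b0c1,
   0x1f22354edcfd7462f3340950055c2, 0xa8b46672c67e21766a3f440010342, 0x13dcd2c018bcb4c0570100c3,
   0x1554df9ceb2eb52054005344, 0x801ae53b97eb3a73800100c4, 0x3a0d77c8ac80c8ab4500100c5,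
   0x16772340e6fab41da05a0100c6, 0x7f52afe73a14bb69e05b0100c7, 0x5730af1435285b3be0542c5348,
   0x264d924f0ac3e2c9023000500c8, 0x1ab72bb88ab27c00002850ce],
  [0x1c16aa2d08f45d2ec5602ca0065c1, 0xff690476b2dd53d826b2180011341, 0x11f224e26bdfffa34c0110c2,
   0x126ed0a915c65560c2006343, 0x8c466a8c04480cc1000110c3, 0x3be9bedd9968c3ba34c0110c4,
   0x171464f7d6e81792405a0110c5, 0x93e2cc0685f5fa2cc05b0110c6, 0x9dcb5f25f0edae5605a006347,
   0x231cc8e32099bf6c085000110c7, 0xccfad1fcb63a4d74524d20110c8, 0x5ca7116c53683ffa2653170910c9,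
   0x4d047278a9060094c60c9],
  [0x1d39d3e063fb5ac5540120c1, 0x50f6aa3204d0070c2, 0x132dead55d260d0c0590120c3,
   0xf9349be5204f0070c4, 0x73bee1364a617c49e05b0120c5, 0xc3a01dc2e234c0070c6,
   0x11ccb64efbcbe16a7da05d0120c7, 0x7a6729c07593e26229605d5120c8, 0x607d9c7bc380094c70c8],
  [0x1a8887bd72bf3504d1008341, 0x3c89a7f42800080c1, 0x16999b34c04e0080c2, 0x1121643a7a04f0080c3,
   0x3121772b4a0500080c4, 0x43510eb243301997205a008345, 0x127e038a2b23400080c5,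
   0xf16f11aa06a4500080c6, 0x38cde774e94a0530080c7, 0x74ad933ec7e2dee19cc05b308348,
   0xde7a00bc240cd29da834401d30c8, 0x60cc9ebbaee7650002880cb],
  [0x3092805040c10090c1, 0x109d5c43a404f0090c2, 0x45030ccf5bf99d1ae3810140c3,
   0xb7dff8573934c0090c4, 0xd1ed8f3990c0520090c5, 0x1b6f862de0df34b0090c6,
   0x9ed0ceacd2dc34c0090c7, 0x1e72b857e27dac90745205f2c9348, 0xce6fe056b57e7ffdb2073400940c8,
   0x654f7cc20b26f90003890ca],
  [0x120f49f7b010200a0c1, 0x66c87e56722ca00a0c2, 0x1b59f54fa1205100a0c3, 0xd972386c76c05200a0c4,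
   0x5a91698c13a805200a0c5, 0x1f8aa4091279e05400a0c6, 0x194b072d5acc35c4152c05e00a347,
   0x58245de04d7d71f5a4437800150c7, 0x66c9a012efd6d1950320c0605d50c8, 0x1b6e9a3ccc0be6f00c0ca0c9],
  [0x760f7696930212ccc09a0160c1, 0x28f1116472805100b0c2, 0xf5e00c2fcea05200b0c3,
   0x1b6f8885087f34b00b0c4, 0x21cd20c6495d024800b0c5, 0x2806a814c9f6a1c563b765800b346,
   0x153d62a6f72a8d502a618000160c6, 0x8ff1bdb165ea776a41ca05f00b347, 0x1a903bd61485c3824754b0c8],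
  [0xf5e5ad9dbb011200c101, 0x58c628e2a2c875666057001601, 0x3d351b0f0e5c05100c102,
   0x22bc7d5899da052001383, 0x229fb3bdc0a3a18300c103, 0x2aa587815ca8ab413ffa51300c384,
   0xcadb7f0ad13066cb6afb300017104, 0x1d167d5e2aab7ca6624c057001605,
   0x24d2a2f7622c448ea2ec06000c385, 0x16fcdfaf520225605700c106, 0xa3f3c2d9f25012056001387,
   0xa49e2a9323adef60c040c107, 0x68ea3eec0c5c60c181401388, 0x5d85e8f5073b80000241111],
  [0x5c4e722a80c010100d101, 0x3c10284bed06204002382, 0x1f8cbc90e114748000d102,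
   0x1d9c61c44f428145312805f00d383, 0x107b85a238c26acbaa6f3380018103,
   0x2c15594add23ecc70076587002604, 0xaee65e7d12187a61970338b00d384, 0x834ac3ca74b65f59300d105,
   0x237c794123efac057002386, 0xad8c46091a3bfc634000d106, 0x2f7c0d36f2e2a77c05900d107,
   0x26c8b7685259f82e053282388, 0x15ba14e87865991a420060d108, 0x1954402fe1d6640000502110],
  [0x23abb59e19da053003381, 0x19bb2cf014e9f44000e101, 0x21f30827beb6d0ada2e005900e382,
   0x118e281ae3de382eb7fff600019102, 0x1c1e7d83132ea0499a3a05e003603,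
   0xa89236374e27032f4b8a78000e383, 0x19d0dea8985243b38d00e104, 0xef008289bce2aa057003385,
   0xab49897d253fb0a05800e105, 0x27ebee3c18070f6030b00e106, 0x15ad77f872d3991cf69900e107,
   0x7b8968ff1d7ed090c1c55ce108, 0x4b99b32c12ea61e03015243389, 0x23541e9cb9bb4000020310f],
  [0x2c157cea8423c743f0ad30b00f381, 0xd9f55d989f8a65cccc4330001a101,
   0x2e5611b75ff0f3f65999511004602, 0x114a203bee87a8317178b54000f382, 0x1ced6fc899a462005700f103,
   0x127b8db167d777c289004384, 0x890961967152eab58000f104, 0x3decf5c359711ea020700f105,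
   0x15388f70d648771e810300f106, 0x760bf2aae22236e5c05900f107, 0x57439c90202861e0e056284388,
   0x2b678e5081ba91f62350024f108, 0x110c89d71eab26300020410e],
  [0x22cea76a6fd0c66b3a3a05f005601, 0x80080d9c482b77be0153300010381, 0x1d39d3e04a449f330b010102,
   0x18f343a30f496b6206005383, 0x83836b7932ecf2c058010103, 0x3be3aa3098ebe860059010104,
   0x1896ec82d3fd1dc7a058010105, 0x5f19fa2b44784f4b205b010106, 0x4f2c707a44270d9c9697005387,
   0x2c42249eca0ecae2304c0010107, 0xea944f8635cdc68d205b285388, 0x108dcc9a04b4aeada835c0190108,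
   0x1a0805e9ecbcf500020510d],
  [0x1ced7edc95a9620057011101, 0x1271293e0d69fa6056006382, 0x807c6956200006102,
   0x41bcf7f5d751111a059011103, 0x10954ffa5204f006104, 0x649400eaca050006105,
   0xbcd96dceca289006106, 0x4703bdc39d930b006107, 0x51628daadaa2053286108],
  [0x1b48c4a34394826101007381, 0x8c470a6feec8524080012101, 0x302d7f8d4207007102,
   0x12330c5e7a04f007103, 0x637fedcd22050007104, 0x25e4a30110c081007105, 0x4695445b9d2051007106,
   0x1b87e9df8a28081007107, 0xda6613bc0921ff2d6545957d2108, 0x22d3db4c327c2f98eecc006507389,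
   0x781e9f4c42561800050710b],
  [0x314d411e11123d2c059013101, 0xc21f8ed7404f008102, 0x66c5f19280050008103,
   0x3121651f30051008104, 0x495c0ef6f6c185008105, 0x5a89a7b306d6289008106,
   0x2a8d1257cee9eee85008593013107, 0x1d31327cfe271dce9b6a05f288388,
   0xdf7b75b4a954d6cbb72c280013108, 0x929a7713f526b20572c810a],
  [0x113b24a7c404f009101, 0x6d1e1aced2309009102, 0x260279b0f30051009103, 0xb89e33d8f28052009104,
   0x4ed9112cf352053009105, 0x23a8728bf70c054009106, 0xf864cf1c8ad14dfd86a05f009387,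
   0xdf9553323c5871cfda83500254107, 0xac8145ea40cdde511aec05e549388, 0xd2a9578d789ae90004c9109],
  [0x66c80a41b005000a101, 0x3212e4268404f00a102, 0xf5dddbafc8c05200a103, 0x1ab632ea9daa05200a104,
   0x221fdbad7c04220700a105, 0x284eda6a02b29c77318e08100a386, 0x3e6b394fedcb9b96bc636c0015106,
   0x103f26c8d3d07d8773f6c08100a387, 0x11f9c1df1db3e6c2895ca108],
  [0x283eaab060c08100b101, 0xe7246f4d86a38d00b102, 0x573b6b74c32a05200b103,
   0x221fdbad9125249100b104, 0x12d7cd26921854d741ec05e00b385, 0x1121f863ec9fe647747cc140016105,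
   0xb1b4e07940afadcabe4b30b00b386, 0x18eb27c07fcfd0a05600b107, 0x957dfb50fe817200583cb108],
  [0x5c539e5ce30c05300c141, 0x37c32e67ce662470013c2, 0x228d73ff407e205400c142,
   0x27fac610bc9106575dc22c600c3c3, 0x1067f33d896cc5522f0cc060017143,
   0x17e9c863376309b9999e553001644, 0xa3fd6f06266f36c741834c000c3c4, 0x1d1b2cc70eae67805500c145,
   0xef0062a270a04a34b0013c6, 0x36ba5bf81e390b5c000c146, 0x2d66ce683b75bd4005900c147,
   0x274a38360c1fa7463ce6413c8, 0x7530795bc3c39de34801cc148, 0x5d8a3336b47933000401150],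
  [0x22e5090da3be04e0023c1, 0x19bb2cdcdbd8f48000d141, 0x256c26a111327f11814405d00d3c2,
   0x107b706634d1383f1907b7de018142, 0x1d72a9f785114ebe6666582002643,
   0xb865239ff21a7e7c26da38000d3c3, 0x1d2d1a07c929bba05700d144, 0x156e6292d2cf8720560023c5,
   0x74e52cab259ab4c24000d145, 0x297a11b0d36b90322ca00d146, 0x15c8249b5b8a7c73614300d147,
   0xc991097e567bd58c1c14823c8, 0x66a5e28832a896b234c020d148, 0x77e1e5cf4adfd30005c214f],
  [0x1d355460b136e8d9ffa77db00e3c1, 0xcbe6dcd2dca9a109dccc055019141,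
   0x1255e7f8a016619a219a056003642, 0xb6a5e564ff5884418a7848000e3c2, 0x118fe55aa8034ca0c200e143,
   0x119a66c11ec44bc0550033c4, 0xaf0ec05519505883c000e144, 0x39cfd8333007cf0765800e145,
   0x17381bbb3e35b817b65700e146, 0x75c413898b3aa909c05b00e147, 0x59bd41721f938f14e4496c33c8,
   0x2e2b51bc497550906eeefab06200499148, 0x685e7d87c9f5fc4ab30001ce149, 0x917d35954e70b00058314e],
  [0x1d72ab725fb8e65a29e6582004641, 0x103f62be498d1bf10213948000f3c1, 0x15b5a3f55665bc405700f142,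
   0x1b5292278c720de1c30043c3, 0x88567e27d3e661048000f143, 0x3bb17476f96613aa45000f144,
   0x173561351c4baaef41c600f145, 0x928b9d575a2b23ade1c500f146, 0x58c5bd1a386ed7c061c20043c7,
   0x2f6b0f1570d30c364930058f147, 0x20774bc4b0219d8d520532843c8, 0x5d870bbb20f4c900008414d],
  [0x1224ffdd79d7fff5d4010141, 0x545f956204d005142, 0x3483e6eb42855d8a058010143,
   0xb5899aa5204f005144, 0x938b09a1fadd4090b554010145, 0xe44c14aaca051005146,
   0x143c5ed6b7851e4fe2005d010147, 0xca12e48cde90c9db024c97453c8, 0x14659a4d21dd82a3440100550148,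
   0x4ce3e1b1ca22400010514c],
  [0x118dc6180190d900520063c1, 0x5f60823e1c0006141, 0x302ea3456248006142,
   0x189ec04dbc8e600b5552011143, 0x637fdfdd6c050006144, 0x1c577538ca2051006145,
   0x5c9ce32556c052006146, 0x3bbf8f83cf1b4d2006147, 0x143c5b0d13ef8ca190c05d3063c8,
   0x24aff218a714c5a3436a640211148, 0x7b663d01abb7c30001c614b],
  [0x41c0d96dd167000c059012141, 0x11286d764a247007142, 0x7f570b1c5363acedc05b012143,
   0x230cc42eba2051007144, 0x46d26925033450007145, 0x5a89a69227802c9007146,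
   0x2ecb8262ae6c24e19a626d9012147, 0xb83593d8ae16013ab8c605e512148,
   0x222af8c70c510ecb91ce0097c73c8, 0x29ab32c214393d00024714a],
  [0x10e2f46e1404f008141, 0x65518dda6534c008142, 0x1a8e0c03113450008143, 0x49cf2a09c9744e008144,
   0x447cf52d22a2053008145, 0x255068826d61b6dc2cc7318013146, 0x113681df1088cbd6a4692060293147,
   0xd7f424546e7b4eddbc900e0083c7, 0x12ae6a8a7abf9d900e148149],
  [0x6ee7f86dbf841fc5405a014141, 0x2688667812234a009142, 0x867dab7f3b0051009143,
   0x53dc05d6ea10053009144, 0x2a4200b04ed711a8541605f014145, 0x1f2de50fd3682ea402cc6580093c6,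
   0xd28305a58fd0a791e303380014146, 0x4053541770d283c8e36283ce654147, 0x19c02edcb23f523012209148],
  [0x25f242d9a2c14200a141, 0xe3ff27d2ab22ca00a142, 0x5c2bbfa6a30c05300a143,
   0x1f8ccb7500fa205400a144, 0x1d1cbf4fe07b97c5f87205e00a3c5, 0x113674feb14694d6d2972060015145,
   0x895384e7344647f178a406000a3c6, 0x126e5d36e876ab60c200a147, 0x3244f38365862161c500a148,
   0x28cd7d6bd1fd0fd414340a149],
  [0xf5dd1da8e5a05200b141, 0x56b7a43f05093ce00b142, 0x21cd7cad9f5d024500b143,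
   0x153c18c3de1518df80a405b00b3c4, 0xff0d02da1f3b2fa3b2237de016144,
   0xb6a59f5d59c40cf5b8ec06000b3c5, 0xd3b23bd15d1a2a05700b146, 0xb5b6134bdc3f5605800b147,
   0x3bc461b2aee034381c554b148],
  [0x22e5090d99da04d001401, 0x229fb3bdc108218200c181, 0x16f3d6f2ea7458d3da0c05c00c402,
   0xe0b547e95bda8e5a8d2c0a0017182, 0x1255e7f777bd43c6199e541001683,
   0x731e657a2f1a68763b6264000c403, 0x1b8df11cb98741b48d00c184, 0x1188955b2d9a7a2057001405,
   0xa5222d45aa7226434000c185, 0x4806e5d5ea4bde005900c186, 0xd37f71ff17109e4605a00c187,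
   0x87ef0dce3545d2ed405b48c188, 0x37a4b10bfe1159a26002441409, 0x11384c65c1350f300038118f],
  [0x2e564a57a919935921aa79b00d401, 0x107b85a233c9c9bed215b500018181,
   0x2c15594add7c9b7ae3e6593002682, 0xff050c4d751e77ca83cb3c000d402, 0x19b53bbc20c2bc959500d183,
   0x11860483ec9a60e04f002404, 0x89310b3592b359c1c000d184, 0x39b1d1e760bce88061700d185,
   0x186568dfda6f6b2c630b00d186, 0x9969d273a457313c05b00d187, 0x7b90a42b9f33485e540f002408,
   0x31b697dffe9d0b5ea444070d188, 0x243bc0e2f82701eba448b702409, 0xb922f02e3e000044218e],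
  [0x1e6de3041a047668b69931f003681, 0x7048508bc7f65ff28f9648000e401, 0x1ced6fc770316cc28900e182,
   0x1176a1fb0fce9aa595003403, 0x6f0bfb6d9d4fea005700e183, 0x2a8b14b9feba9d2205800e184,
   0x134ad79c4034f884405a00e185, 0x13850c548d756b49605b00e186, 0x4f2c7035cf1daa779694003407,
   0x27e38a5fa7f487eb274801ce187, 0x21f228ac19ff91eba605c2c3408, 0xfd4ae079f2134600048318d],
  [0x127dd0436bb60e005700f181, 0x4e554e6204d004182, 0x380353ab84665eb059500f183,
   0xb02c3baaa04f004184, 0x2661111aaa050004185, 0xbccbc3764a289004186, 0x5597be7c3aa052004187,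
   0x1a8ca7db37062894c4188],
  [0xff3d4ba40dd374101005401, 0x4e55b081300005181, 0x1f400aee004e005182,
   0x76550ae2ad55ce6405a010183, 0x471819b786081005184, 0xbc39135e9a051005185,
   0xfd8ac08d6c052005186, 0x1a8cae1c6765491005187, 0x2c30254fc209db11be76103650188,
   0x15149a648fd9e358428c00b5c5409, 0x5f4192b31b466300014518b],
  [0x4194a56199cd640b595011181, 0xc2159522a04f006182, 0x1e9b2ec598081006183,
   0x25e538a608a30a006184, 0x46d1dce225940f006185, 0x5ac5895b1fd6289006186,
   0x1e0f3827ae47f6d5ddea05e011187, 0xabdd190d071664c04ef00604d1188,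
   0x128cd2d6a1a27c68fd4a013746408, 0x6176fedbffab2300010618a],
  [0x120caf5f9404f007181, 0x639719d34204f007182, 0x25e67e1e28c081007183, 0x4797d224fe2288007184,
   0x37bde9a6e9dc491007185, 0x38a172b0d43bb9d5f4c05f012186,
   0xef00ccfb0b85dff84fd8b7c46a006b55d187, 0x11abe48c74197f2526cd00b007407,
   0x72ed86575271d810b42c060307408, 0x809f72aa0dcf22400107189],
  [0x6d329a5370081008181, 0x26638bde0af30b008182, 0xde234b3864a051008183,
   0x5ac4b9ca0456288008184, 0x2eb2d97d83a6585e1dea05f013185, 0x1b64a7b3bac4fc2f94c7513008406,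
   0xb12749b174709c9be25e060013186, 0xae652574930095ce5d72593008407, 0x1866e491c76b00c2895c8188],
  [0x28a96fe9210182009181, 0x498d6efb67230a009182, 0x37ca6520c003491009183,
   0x2e56423ca45726cc2fa0508014184, 0x1dec59215470ac138e1805b009405,
   0xb4acb1629a5fe098bf12780014185, 0xefbad6dcf9ebaf014fe4286009406, 0x102b96c82b3f920057009187,
   0x9269f71323617200583c9188],
  [0xe5f847b7e3c10300a181, 0x251e4272540c05300a182, 0x221feafeca23a20300a183,
   0x19eca31a29bc449153b851300a404, 0x8c707bd8a6181e5c03fe060015184,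
   0xb7560d64face652ead8608100a405, 0x142cd3120f0a60405700a186,
   0xde6a0770081412e8da34cc9ef0eba3de120187, 0x15ba1562e6412648c0583ca189],
  [0x5c361197e93c05300b181, 0x221feafecab9e4cc00b182, 0x29898e784c34df06999c28200b403,
   0x118e2a5afb50a6227cf48540016183, 0xaec56534ee6faa717cc805d00b404, 0x82dfb6f950590210300b185,
   0x951a5348774f91418500b186, 0x29a11a4b3aae2c7605800b187, 0xd51d068a3cf560f618548b188],
  [0x1c4672c89298e698e4fa2ca00c441, 0xff86ef8dcfd6a87308921400171c1,
   0x1e6de3041a047662f07605a0016c2, 0xb73cfb51c1bfa79c877838000c442, 0x132f586b7bb164c14400c1c3,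
   0xa3ab0117dd295a055001444, 0x136f2c29aacd5c558000c1c4, 0x402fba6c0e80f77405900c1c5,
   0x15ae11968efe121a02ca00c1c6, 0x9c6ec4eaa5df45a62191e4f58cb6171c7,
   0x71cde730d1987167600764c1c7, 0x39f074e9f4255e0c800b501448, 0xcbb3c0e24bd00004c11ce],
  [0x2be8f6444717f19999262540026c1, 0xa8b4669bd9b7b7bb81596c000d441, 0x13ff61420d82f3605600d1c2,
   0x11769f213a55cbb54f002443, 0x94d280178e62bbb38000d1c3, 0x40de541c81aba76534c00d1c4,
   0x729eabdd129e39283ce00d1c5, 0x904be359247dd8f8e2da00d1c6, 0x7b91b18e603650b4a347002447,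
   0x30fa353ad9c3e8c5c63ce00d1c7, 0x222571e0877f2b3fcc059302448, 0x95e7cff80f0d58d84d60028d1c8,
   0xafda0ecbdc631c0003c21cd],
  [0x12712b88f4f8b4c0c200e1c1, 0x1b4706b12bc404610f003442, 0x4dedc1861400031c2,
   0x418907a98c9b499205900e1c3, 0x1574985d698b914722c900e1c4, 0x82767934abe12bc2005a00e1c5,
   0x19875900e220510031c6, 0x1473a2931416499895c05d00e1c7, 0x6a915fc695960d0bff134b70e1c8,
   0x38cdecb09a2300e1431c8],
  [0x118ad41ab25cce6057004441, 0xaf0956d641940ca0c000f1c1, 0x1fa34004004e0041c2,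
   0x542a894a034c0041c3, 0x44139a0b4204f0041c4, 0x1dc568b6f660510041c5, 0xe35bb4d15654500041c6,
   0x7d3b51ce67cc7a5e9ec77e725b9cb71a1c7, 0x12bafabf952d7ed2325012244447,
   0xdeabb2c8b7e20dce84c0117cf1c8, 0xfa7ae8cb5b65000000441cb],
  [0x23eb90be06b07d2c0580101c1, 0x110a9696441c60051c2, 0x472f84c14b38c0051c3,
   0x27ed269cc662480051c4, 0x972589c2d6c0520051c5, 0x53fbaf71bc580520051c6,
   0x1d9475642441d78e994e05f0101c7, 0x1c11b7818cba166e598e5537c5448,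
   0x15027bdeb0539c06696b5c03101c8, 0xf97f74a34ec15e0001c51ca],
  [0x1898f58d2a6b75a8a05a0111c1, 0x41d60a000c0500061c2, 0x1aa82d281134500061c3,
   0x623096a1cda0520061c4, 0x37bde9b7a6d14500061c5, 0x280d44a936ec09c50c1c0c20111c6,
   0x29f50b8f1f678343453605d006447, 0x2e0b9db01d6e1054142405f0111c7,
   0x2ab11da83b71977c653d51ded538a4a65c1c8, 0x2fc076c7810befd48b38c0077d11c8,
   0xd4087aa31b16e900b5061c9],
  [0x6ee7f906b4f5fc77405b0121c1, 0x2857e5ef6e22480071c2, 0x867dcc2c41a0510071c3,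
   0x5ac472756d802c90071c4, 0x2024312ebd803be485ac05f0121c5, 0x1e6de1c387143b5ab05205f007446,
   0xaec038e1ba53872d7fff4000121c6, 0x962e679ba6ff70f469be4c9007447, 0x11bd9346aea194e3495c71c8],
  [0x26617e8deb00500081c1, 0x9e376afafa20c20081c2, 0x22c7922f4b3e0530081c3,
   0x2eb2d97ee21070fc1c004d10131c4, 0x1c16abbfb287e1fd2bc02c6008445,
   0xe0ad5984c4533f5217a18000131c5, 0xf50381f1fb4a9553b31175c008446, 0xfaa9f8a018cdb61440081c7,
   0x5995e6d1215def61434081c8],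
  [0xe82eea09a580500091c1, 0x51903d90cf0c0500091c2, 0x2ebbe962666bbbde45a775c0141c3,
   0x1c46706314008949601e554009444, 0x1035fe84e72b025fd6c083800141c4,
   0x10697c08ca19bd705b753550009445, 0x6c77e745548ea40570091c6,
   0x13d0a5d303dffad6e77398362677f03ae61f1c7, 0x4076da377c98d9f205a2c91c9],
  [0x5c3366ac79cc05200a1c1, 0x1f8ccb75167e205400a1c2, 0x1c16e2cb861ed0c8e6fa2c900a443,
   0x10699afe326c771091e9b6800151c3, 0xa88f62b44fe01b1fd03956000a444, 0x1a94abebcd084d205700a1c5,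
   0x955f9827ace3e1c34b00a1c6, 0x27ff903f0c5597920c200a1c7, 0x369484d8a0d0a939f92c0b606368a448,
   0xff3baa212222671830058a1c8],
  [0x21cd7cae2075024100b1c1, 0x2c157ce957f161af87325c800b442, 0x107b063a1c2394a3e7d2c7000161c2,
   0xfcec6f1400a6acfee81a05f00b443, 0x127dd94a82787be24800b1c4, 0xa3c7db12f02f29e34800b1c5,
   0x12d868a10999ab4345000b1c6, 0xd3c540a932aae87434b00b1c7, 0x5fb9d58b1ed4306a605b2cb1c8],
  [0x1d6390dc93a869999996541001701, 0xa892363849acfd37cfd269700c481, 0x11a31492212e3fa05400c202,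
   0xa3f42119694466051001483, 0x170328a693280b424000c203, 0x1dade36d6d89568a05800c204,
   0xf9413033bf5c869c28900c205, 0x66b32f2176ee6e2a605a00c206, 0x4b9ccad78b316788a184001487,
   0x33570f9bd1af46be7f60000c207, 0x220e913a65be01eba60542c1488, 0x131dec53ffaa38002961c050c208,
   0xfd12373d1f741500008120d],
  [0x1756fa21aef7d4205600d201, 0x4eedbc2204d002202, 0x130eac75204e002203, 0xaad249b6a04f002204,
   0x1f8ff370b930b002205, 0x508c005a9a5f921b9512002486, 0x27ee96efb724385b0554000d206,
   0x55979a0b4ea052002207, 0x1a8ca77a09e62894c2208],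
  [0x118ad41171862c958e003481, 0x4eee080b340003201, 0x1fa35fc6204d003202, 0x7776a8b6a04f003203,
   0x4210965f56050003204, 0x18311c9e02940f003205, 0x9ff0f043d06081003206,
   0x22bc75021fda053003207, 0x490c67433cb652307d605a2c3488, 0xdeabc857b9544eea06564024e208,
   0xcb9b0370d1ce0001c320b],
  [0x282b2941cfc3b1b205800f201, 0x110a8fabfc206004202, 0x297fcf528e050004203,
   0x14ed1520e2a050004204, 0x559a96986aa052004205, 0x5ac4712565d6288004206,
   0x218b0c4206d9100f52aa05f00f207, 0x1112e24071fc1f6ca8bd40a038f208,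
   0x5de51b4659183959b6400b784488, 0x849cdc076c774c00040420a],
  [0x112ea234d604f005201, 0x472fa08286081005202, 0xbcd7aa109038c005203, 0xf39a2d3e356052005204,
   0x3fc97a4504da053005205, 0x280c17faecf51b35434b617010206, 0x2c15594c09564a93f11b30b005487,
   0xac75ad73f1d6472b8e84780010207, 0x44b7ad5e224904c83d63c081310208, 0x1a2fcb6af4a5dd800b045209],
  [0x65517ff898081006201, 0x25b7d373f22287006202, 0x94a570d4f3040f006203,
   0x3810d3b8fbbe053006204, 0x1da30334cb18fd07aaf005d011205, 0x1d0dfe3d02320296be4a05f006486,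
   0x80073c886a5ec1ea9a8a700011206, 0x107581ae0a1e854250e46060006487, 0xeef98880048a38287546208],
  [0x18cbc2fdcb038d007201, 0x943bf7d22f2207007202, 0x56515ee18cec081007203,
   0x2ea99a3d5198c109441948b012204, 0x1034579ce13b2f835fd805f007485,
   0x1136824a4a7410a5e23de060012205, 0xac22d4605299f5df20ee060007486, 0xefca8b5a40724a057007207,
   0x6bd6e54948d1a02056347208],
  [0xe5f8472003c102008201, 0x399c79f6ee06053008202, 0x1da625281bf5f97390025c7013203,
   0x2e55ee8dfe7af40b80e4513008484, 0x86896590be5b33a31a7b5c0013204,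
   0xa7f6ce772c2626e39e16060008485, 0x1b4e9e28056260057008206, 0xa35a1b69e6d6604207008207,
   0x3aeb580c376de70c057388208],
  [0x5affbe2baebc081009201, 0x2ecd0cdafcfbe5c96ba005f014202, 0x2b454922cf3639ee496205c009483,
   0x118e2a4b0d8cc61880b18540014203, 0x9c071aef9885b009830e306009484, 0x127bc058f2a5610055009205,
   0x5ed1c0a937f8e53490009206, 0x2331902f36e2bbd8617009207, 0xec06e597706e8854207489208],
  [0xa5621565075028700a201, 0x1c16a54ec466ff4c53b805d00a482, 0x1041434a976d109946392060015202,
   0xff68e19e2c907f08e61961300a483, 0xfcaf0e97baca5a30a00a204, 0x9f5f8d710ca9f0a51100a205,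
   0x505aefb42430fc405700a206, 0xf0032eab95508d0f61700a207, 0x92a1f42c4580714782a3f5606434a488,
   0x7e224c7657d4d4d5c3405ca208],
  [0x1d1cbf7a0f3c7fae14d335800b481, 0xdd110e308d2edfd81ed2480016201,
   0x705dc19bd26a583c2ea609e00b482, 0x1a92191152c5cf005700b203, 0x324230da2b6c63130b00b204,
   0x381fdb1d3239b3ac05900b205, 0x1669722fc062fc4ac20600b206, 0x2a7786a1160e592a605b00b207,
   0x2130f83aee507b73dc28950b208],
  [0x1d39c3cce94afac55400c241, 0x118909ac5d715e604e0014c2, 0x77f16ebf6dcf86405700c242,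
   0x41988abf6d0e9aa144f00c243, 0x1669b0acac70d810f34b00c244, 0x39859f452cf989d0405a00c245,
   0x57434df731c2d23be0590014c6, 0x24788f260c54fa1b4e05b00c246, 0x12e751a37ae47abf72c05d00c247,
   0x222cb2c480d3cdda94a05d34c248, 0x2f13672f7a2300e141248],
  [0x5f1e06c604d002241, 0x1d5f8526204d002242, 0x18a6ccb9f5c1421185d400d243,
   0x82b0e04d67218051a34a00d244, 0x2ae0fd3b66051002245, 0x7d89051a5c2051002246,
   0x42eda7b83b66053002247, 0x20fcdb2edb0d055a7d605d2c24c8, 0x38385a15a5011ec206578024d248,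
   0x12797467f3d4e0005c224b],
  [0x2d6a8a3d604e003241, 0xbdd1089d604f003242, 0x7259fba66050003243, 0xbec16a759e0c1003244,
   0x5d092d0d8ea052003245, 0x37418d4a64da053003246, 0x2ecb8262b12c10f0320c14100e247,
   0x113681df0d9dc5d79a37805f58e248, 0x159136d487d2e63e32e400b6034c8, 0xdfaab47b38212800038324a],
  [0x110a2e2d2e04f004241, 0x4216d8d9720c1004242, 0x1840c4539cd34c004243, 0xe363170baa134c004244,
   0x3bfa5b69605b4d2004245, 0x27b1fb41584e34dd1cd405f00f246, 0x190e003caf0b99af0d4e2480044c7,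
   0xb0b0cda0596bfa11a4f130068f247, 0x50fb69b9e651d06843db34b5844c8, 0x16879394ad496bf0000c4249],
  [0x472fa082a034c005241, 0x18c8aee7816205005242, 0xe24e886ae8c0c1005243,
   0x562f1eb842622ca005244, 0x187245282d51e3c7773405f010245, 0x1d1c70eea5cefb67b4a65d20054c6,
   0xd7bb8b005dd0b4295f88280010246, 0xeec0a5630abab8469b9a1c10054c7, 0x12feb04e0e219e60562c5248],
  [0x1e354a242b6051006241, 0xa17dc3723d6144006242, 0x42edd0a2cf0a053006243,
   0x2ed04de0614d1b820e54450011244, 0x1910a288597ebee1fb637dc0064c5,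
   0xdc5cd99358e6c2f713ec180011245, 0xab2146b7eed34c8e8d0c05c0064c6, 0xefcc24fade3586056006247,
   0x1430bf879e1fd0189ddaa945c1864c8, 0x55f5462c34e9a62440186248],
  [0xb4a5ff2470a051007241, 0x4eadf34693da051007242, 0x2aa47be7571d020c161f79a012243,
   0xe003c53f044164af9545540074c4, 0xaee71096a19649157b2e34a012244,
   0x962e679ba920875f09e93cc0074c5, 0x823b4688f54d14248007246, 0xa1bdaf5b47d1612058007247,
   0x3aeb89b36d3f0d8a0583c7248],
  [0x5732af02d6e8050008241, 0x2562e09fa57eb918122405a013242, 0x2b461ed2db41480f3a2405d0084c3,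
   0xdf966e823626f7de8d30060013243, 0xff68dd64f1caa8e700180590084c4, 0x1b4b5621759f02c141008245,
   0x5f7bc4293afe140058008246, 0x57239968d6f93239008d666064393247, 0x5b1605b8c595f412d00e108249],
  [0x2573173171362643702c05c014241, 0x1e6de3041b69e59d35d205f0094c2,
   0xb5b5df5c337fbbdbb2ec3c0014242, 0xaee643d2f662694386196550094c3, 0x19c01a08e2330dc056009244,
   0x6d0aedfc721f4720c1009245, 0x3bab90b4f057a7be4d2009246, 0x37f36520c0c1e2777886fae0612c94c7,
   0x208550c28fa0d148b8c51db93008d4247, 0x87462412afb3047170002c9248],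
  [0x2aa5877f43315839340c24800a4c1, 0x1121e3becad3ca0290bd4200015241,
   0xa99148beb265d08c808531f00a4c2, 0x18eb2e1bb6a56b955400a243, 0x9a94c830936c18405700a244,
   0x3de374bac1c381fa2c400a245, 0x97cf248e51876a4605a00a246, 0x7e47084b7c36b7d663cc00a247,
   0x30eb8f1e542cdddd7a29ff5646588d5248, 0x1160572f6299811fbd624154a249],
  [0xfd7ccf7d81b87c4ed2b660600b4c1, 0xfeb60997b04e0544e00b242, 0xad73691bd80cca005500b243,
   0x2984993f8276754205800b244, 0x18944759f2e64a3ab45000b245, 0x81619b2563d3493a534b00b246,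
   0x1927ef442fb288e29205c00b247, 0x125756f062f1a5f64ca05c4cb248],
  [0x4ddc72e130b001281, 0x1d1c35c1e081001282, 0xb195d1aa930b001283, 0x400edba3d6050001284,
   0x1805925d6fb38d001285, 0x9140ccab4da081001286, 0x37bd97a856fb491001287,
   0x490c6743a71fa55a7d60542c1508, 0x2315d529c10edcb4ab4b70020c288, 0x849cdc1badadcd00034128b],
  [0x1d38ff80930b002281, 0xaad249d2e04f002282, 0x421066db3b30b002283, 0xbd5fb819ac184002284,
   0x5597c0f2fc2050002285, 0x31b6fd156fbe053002286, 0x1d1c9258e73e045a6d3405e00d287,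
   0xaee2261d4aa7eb9c5d6c0605cd288, 0x2332655826ff8a737eca003642508, 0xe1b3a14acb600c00044228a],
  [0x7776a8d2e08f003281, 0x41b20227ec050003282, 0x1e19da651a204e003283, 0x91415e03082185003284,
   0x5668e9c118d8053003285, 0x28f63b8a0b4151abebe749100e286,
   0x6eb2c70bdb8e6c9beed9c15361b9cb619287, 0x1956f970cf47f5ea4be5014003507,
   0xb38a15cde0c230629ec605e2c3508, 0xee5bc1eefb774e140483289],
  [0x42b3d332bb30b004281, 0x18fe9766aee051004282, 0x700c047331a052004283,
   0x55389767d9a4286004284, 0x1f22fe18aaa18fdc1b9330b00f285, 0xd2b86a2c722c6e19d54081004506,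
   0xf802cf831488a113c5e844000f286, 0x307c162099f846056004287, 0xee521da2b3ac6c2895c4288],
  [0x1aa8a884b4840d005281, 0xde4abfcba16051005282, 0x1aaf24dcdf4b40c005283,
   0x1bbac90728078236f874081010284, 0x1d1892beb19a87a5464c057005505,
   0x7e0dbd31ef7d0be138244c0010285, 0xa873a396bf7cc519222638d005506, 0xfa3a4678456fa0594005287,
   0x68e681ca15f828c181405288],
  [0x64e06aac3ba052006281, 0x3ca2186f6d90051006282, 0x2c318fc4900cad0df53205e011283,
   0x1d355dd05b2f4da17fd805f006504, 0x117f11f2a75945da1644a6c0011284, 0x30835ca82c4ff0055006285,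
   0x18f57ee39bae3d340e006286, 0x98f29cd74d9cf72206006287, 0x3b0aa80ed7d2d60c059406288],
  [0x37c38a0f58bb490007281, 0x2c1a618401e38061470c05d012282, 0x1c16abbe2634d618aae079a007503,
   0xf7f738e1f628512f6b9b5c0012283, 0xa8ec0247d80095aa6e1f38b007504, 0x17537adc34dfa32054007285,
   0x5dab47714bc3005512007286, 0x299a236d18c65952059007287, 0xc91d883bb6aa148a05a447288],
  [0x2a8cbaccd7baa0e4513205d013281, 0x27bbe3b832333411fb66081008502,
   0xdf969db423bdee041eed4c0013282, 0x30835cb2af7678055008283, 0x15bf79832e89260055008284,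
   0xbbd7260b4492fc057008285, 0x2afeda9563be308b616008286,
   0x119848350fce74435369b1e5428002bbf51482878d3787, 0x23c4af1c1bee52b51028f8f3800c8507,
   0xf523018c0420316f680008287, 0x2a633f2f28188370e48e6c8288],
  [0x1c16aa2b2deb09387f21319009501, 0xb4ab94f2ca193f5de24c680014281,
   0xa8ec02296b29db14807e38c009502, 0x1b8ca31d1077324203009283, 0x5fbdf9c9c20ea1348e009284,
   0x381f916c5299448238a009285, 0x1009e9ba7ff9d0bf405a009286, 0x1fd1fe5d35bb5bfc205b009287,
   0x314b9db1403064786d719009288, 0x5d6223890aae11ec1c38b5c9289],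
  [0x308391d46d2f5005100a281, 0x175f26cd6f6ac2c0d700a282, 0x836f6e3a15f83cc05600a283,
   0x395b09e91806b14428900a284, 0xda121e33ef915edc05a00a285, 0x2c0dbe19566fd1bf205b00a286,
   0xe66a73f2b75250b7375b4134b897aa279dc55507, 0x222571a684c6172dcc2805ca287,
   0x9ff28a2554d8c991c60075ca288],
  [0x127bc01dd35237209700b281, 0x6ab009c626a40f620600b282, 0x4191978d0c4d7b6205900b283,
   0x1365b49ca6932a9b405a00b284, 0x4f507a90a7214961e38d00b285, 0x34500fca82782cf55808100b286,
   0x5b8362bc2eb909d1a005d00b287, 0x221b4da4c4367b9fe0c05c30b288]]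

theorem valid_table10 : (table10.all fun t => t.all (valid 10)) = true := by decide +kernel

theorem complete_table10 : complete 10 19 table10 = true := by decide +kernel

end BHR

theorem mainTheorem5 (U : Finset ℕ)
    (hU : U = {1, 7, 8} ∨ U = {1, 9, 10} ∨ U = {1, 10, 11}) :
    (∀ (v : ℕ) (L : Multiset ℕ), IsBHRInstance v L → L.toFinset = U →
      (∀ l ∈ U, Nat.Coprime v l) → IsRealizable v L) ∧
    BurattiHoldsFor U := by
  have key : ∀ (v : ℕ) (L : Multiset ℕ), IsBHRInstance v L → L.toFinset = U →
      (∀ l ∈ U, Nat.Coprime v l) → IsRealizable v L := by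
    intro v L hL hLU hv
    rcases hU with rfl | rfl | rfl
    · exact BHR.isRealizable_of_complete (by norm_num) BHR.valid_table7 BHR.complete_table7 hL hLU hv
    · exact BHR.isRealizable_of_complete (by norm_num) BHR.valid_table9 BHR.complete_table9 hL hLU hv
    · exact BHR.isRealizable_of_complete (by norm_num) BHR.valid_table10 BHR.complete_table10 hL hLU
        hv
  exact ⟨key, BHR.burattiHoldsFor_of_coprime key⟩
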